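/- **Setting.** A metric space is boundedly compact if all its closed balls are compact. Let $\mathrm{Comp}$ be the category of compact metric spaces (the empty space included) with isometric embeddings as morphisms. Let $\mathrm{Pos}_m$ be the category whose objects are the extended metric spaces $A$ with a partial order such that every cone $\{a'\in A: a'\le a\}$, $a\in A$, is compact, and whose morphisms are the order-preserving isometric embeddings. Let $\tau:\mathrm{Comp}\to\mathrm{Pos}_m$ be a functor, $f\mapsto\tau_f$. A *truncation functor* $\tau^t$ for $\tau$ is a contravariant functor from $\mathrm{Comp}$ to posets (with order-preserving maps) with $\tau^t(X)=\tau(X)$ as posets for every $X$, such that for all isometric embeddings $f:X\to Y$ of compact metric spaces and all $a\in\tau(X)$, $b\in\tau(Y)$, $$\tau^t_f(\tau_f(a))=a,\qquad \tau_f(\tau^t_f(b))\le b .$$ *The extension $\varphi$ and the space $\mathcal C'$.* For a boundedly compact metric space $X$, let $\varphi(X)$ be the set of families $a=(a_S)_S$, indexed by the compact subsets $S\subseteq X$, with $a_S\in\tau(S)$ and $\tau^t_\iota(a_T)=a_S$ for every inclusion $\iota:S\hookrightarrow T$ of compact subsets. For compact $X$, $a\mapsto a_X$ is a bijection $\varphi(X)\to\tau(X)$,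 and the two sets are identified. For a surjective isometry $f:X\to Y$ let $\varphi_f(a)_T:=\tau_g(a_{f^{-1}(T)})$, where $g:f^{-1}(T)\to T$ is the restriction of $f$. Let $\mathcal C'$ be the space of isomorphism classes of tuples $(X,o;a)$ with $X$ boundedly compact, $o\in X$ and $a\in\varphi(X)$; here $(X,o;a)$ and $(Y,o';b)$ are isomorphic if some surjective isometry $f:X\to Y$ satisfies $f(o)=o'$ and $\varphi_f(a)=b$. A tuple is called compact if its underlying space is compact. *Comparison of compact tuples.* For compact tuples let $$d^c\big((X,o;a),(Y,o';b)\big):=\inf_{Z,f,g}\ \max\big\{d_H(f(X),g(Y)),\ d(f(o),g(o')),\ d(\tau_f(a),\tau_g(b))\big\}\in[0,\infty],$$ over all compact metric spaces $Z$ and isometric embeddings $f:X\to Z$, $g:Y\to Z$, where $d_H$ is the Hausdorff distance. *Truncations and order.* For $\mathcal X=(X,o;a)$ and a compact $S\subseteq X$ containing $o$, the truncation of $\mathcal X$ to $S$ is the compact tuple $(S,o;a_S)$. For $r\ge 0$ let $\mathcal X^{(r)}$ be the truncation of $\mathcal X$ to the closed ball of radius $r$ about $o$. For a compact tuple $\mathcal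 X'=(X',o';a')$ write $\mathcal X'\preceq\mathcal X$ if $X'\subseteq X$ (with the restricted metric), $o'=o$ and $a'\le a_{X'}$ in $\tau(X')$. **Assumptions.** 1. For every compact metric space $X$, every surjective isometry $f:X\to X$ and every $a\in\tau(X)$: if $\tau_f(a)\le a$, then $\tau_f(a)=a$. 2. For all compact tuples $\mathcal X,\mathcal Y$ and every $\mathcal X'\preceq\mathcal X$ there is $\mathcal Y'\preceq\mathcal Y$ with $d^c(\mathcal X',\mathcal Y')\le d^c(\mathcal X,\mathcal Y)$. 3. If in (2) $\delta:=d^c(\mathcal X,\mathcal Y)<\infty$, $r\ge 2\delta$ and $\mathcal X^{(r)}\preceq\mathcal X'\preceq\mathcal X$, then $\mathcal Y'$ can be chosen such that in addition $\mathcal Y^{(r-2\delta)}\preceq\mathcal Y'$. 4. For all compact metric spaces $Z,X,X_1,X_2,\dots$ and isometric embeddings $f:X\to Z$, $f_n:X_n\to Z$ with $d_H(f_n(X_n),f(X))\to0$: if $b\in\tau(Z)$, $a_n\in\tau(X_n)$ and $\tau_{f_n}(a_n)\to b$, then $b\in\tau_f(\tau(X))$. 5. $\tau$ is pointwise-continuous: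 for all isometric embeddings $f,f_1,f_2,\dots:X\to Y$ of compact metric spaces, if $f_n\to f$ pointwise, then $\tau_{f_n}\to\tau_f$ pointwise. **Theorem.** Let $\tau$ be a functor with a truncation functor $\tau^t$ such that assumptions 1–5 hold. For tuples $\mathcal X,\mathcal Y$ as in the definition of $\mathcal C'$ and $0<\epsilon\le1$ let $$a_\epsilon(\mathcal X,\mathcal Y):=\inf\big\{d^c(\mathcal X^{(1/\epsilon)},\mathcal Y')\;:\; \mathcal Y' \text{ compact},\ \mathcal Y^{(1/\epsilon-\epsilon)}\preceq\mathcal Y'\preceq\mathcal Y\big\}.$$ Then $$d(\mathcal X,\mathcal Y):=\inf\Big\{\epsilon\in(0,1]:\ \max\{a_\epsilon(\mathcal X,\mathcal Y),\,a_\epsilon(\mathcal Y,\mathcal X)\}<\tfrac{\epsilon}{2}\Big\},\qquad \inf\emptyset:=1,$$ depends only on the isomorphism classes of $\mathcal X$ and $\mathcal Y$ and defines a metric on $\mathcal C'$. -/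

import Mathlib

universe u v

open TopologicalSpace Filter Topology
open scoped ENNReal

noncomputable section

namespace GHFunctor

/-- Isometric embeddings: the morphisms of the category of compact metric spaces. -/
structure IsomEmb (X Y : Type*) [MetricSpace X] [MetricSpace Y] where
  toFun : X → Y
  isometry : Isometry toFun

instance {X Y : Type*} [MetricSpace X] [MetricSpace Y] : CoeFun (IsomEmb X Y) (fun _ => X → Y) :=
  ⟨IsomEmb.toFun⟩

namespace IsomEmb

/-- The identity morphism. -/
def id (X : Type*) [MetricSpace X] : IsomEmb X X := ⟨fun x => x, isometry_id⟩

/-- Composition `g ∘ f`. -/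
def comp {X Y Z : Type*} [MetricSpace X] [MetricSpace Y] [MetricSpace Z]
    (g : IsomEmb Y Z) (f : IsomEmb X Y) : IsomEmb X Z :=
  ⟨fun x => g (f x), g.isometry.comp f.isometry⟩

/-- The inclusion of a compact subset into the whole space. -/
def subtype {X : Type*} [MetricSpace X] (S : Compacts X) : IsomEmb S X :=
  ⟨fun x => x.1, isometry_subtype_coe⟩

/-- The inclusion `S ↪ T` of compact subsets `S ⊆ T` of `X`. -/
def incl {X : Type*} [MetricSpace X] {S T : Compacts X} (h : S ≤ T) : IsomEmb S T :=
  ⟨fun x => ⟨x.1, h x.2⟩, fun _ _ => rfl⟩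

end IsomEmb

/-- A functor from compact metric spaces (with isometric embeddings) to extended metric spaces
(with isometric embeddings). -/
structure MetFunctor where
  obj : ∀ (X : Type u) [MetricSpace X] [CompactSpace X], Type v
  emetric : ∀ (X : Type u) [MetricSpace X] [CompactSpace X], EMetricSpace (obj X)
  map : ∀ {X Y : Type u} [MetricSpace X] [CompactSpace X] [MetricSpace Y] [CompactSpace Y],
    IsomEmb X Y → obj X → obj Y
  map_isometry : ∀ {X Y : Type u} [MetricSpace X] [CompactSpace X] [MetricSpace Y]
    [CompactSpace Y] (f : IsomEmb X Y), Isometry (map f)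
  map_id : ∀ (X : Type u) [MetricSpace X] [CompactSpace X] (a : obj X),
    map (IsomEmb.id X) a = a
  map_comp : ∀ {X Y Z : Type u} [MetricSpace X] [CompactSpace X] [MetricSpace Y]
    [CompactSpace Y] [MetricSpace Z] [CompactSpace Z] (g : IsomEmb Y Z) (f : IsomEmb X Y)
    (a : obj X), map (g.comp f) a = map g (map f a)

attribute [instance] MetFunctor.emetric

/-- A functor from compact metric spaces to the category whose objects are the extended metric
spaces with a partial order all of whose cones `{a' | a' ≤ a}` are compact, and whose morphisms
are the order-preserving isometric embeddings. -/
structure PosFunctor extends MetFunctor.{u, v} where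
  order : ∀ (X : Type u) [MetricSpace X] [CompactSpace X], PartialOrder (obj X)
  isCompact_cone : ∀ (X : Type u) [MetricSpace X] [CompactSpace X] (a : obj X),
    IsCompact {a' : obj X | a' ≤ a}
  map_mono : ∀ {X Y : Type u} [MetricSpace X] [CompactSpace X] [MetricSpace Y]
    [CompactSpace Y] (f : IsomEmb X Y), Monotone (map f)

attribute [instance] PosFunctor.order

/-- A truncation functor for `τ`: a contravariant functor to posets with the same values on
objects as `τ`, such that `τᵗ_f (τ_f a) = a` and `τ_f (τᵗ_f b) ≤ b`. -/
structure TruncFunctor (τ : PosFunctor.{u, v}) where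
  trunc : ∀ {X Y : Type u} [MetricSpace X] [CompactSpace X] [MetricSpace Y] [CompactSpace Y],
    IsomEmb X Y → τ.obj Y → τ.obj X
  trunc_mono : ∀ {X Y : Type u} [MetricSpace X] [CompactSpace X] [MetricSpace Y]
    [CompactSpace Y] (f : IsomEmb X Y), Monotone (trunc f)
  trunc_id : ∀ (X : Type u) [MetricSpace X] [CompactSpace X] (a : τ.obj X),
    trunc (IsomEmb.id X) a = a
  trunc_comp : ∀ {X Y Z : Type u} [MetricSpace X] [CompactSpace X] [MetricSpace Y]
    [CompactSpace Y] [MetricSpace Z] [CompactSpace Z] (g : IsomEmb Y Z) (f : IsomEmb X Y)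
    (c : τ.obj Z), trunc (g.comp f) c = trunc f (trunc g c)
  trunc_map : ∀ {X Y : Type u} [MetricSpace X] [CompactSpace X] [MetricSpace Y]
    [CompactSpace Y] (f : IsomEmb X Y) (a : τ.obj X), trunc f (τ.map f a) = a
  map_trunc_le : ∀ {X Y : Type u} [MetricSpace X] [CompactSpace X] [MetricSpace Y]
    [CompactSpace Y] (f : IsomEmb X Y) (b : τ.obj Y), τ.map f (trunc f b) ≤ b

/-- Pointwise-continuity: if `fₙ → f` pointwise then `τ_{fₙ} → τ_f` pointwise. -/
def MetFunctor.PointwiseContinuous (σ : MetFunctor.{u, v}) : Prop :=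
  ∀ (X Y : Type u) [MetricSpace X] [CompactSpace X] [MetricSpace Y] [CompactSpace Y]
    (F : ℕ → IsomEmb X Y) (f : IsomEmb X Y),
    (∀ x, Tendsto (fun n => F n x) atTop (𝓝 (f x))) →
    ∀ a : σ.obj X, Tendsto (fun n => σ.map (F n) a) atTop (𝓝 (σ.map f a))

/-- If `Im fₙ → Im f` in the Hausdorff distance and `τ_{fₙ}(aₙ) → b`, then `b ∈ Im τ_f`. -/
def MetFunctor.LimitsInImage (σ : MetFunctor.{u, v}) : Prop :=
  ∀ (Z X : Type u) (W : ℕ → Type u) [MetricSpace Z] [CompactSpace Z] [MetricSpace X]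
    [CompactSpace X] [∀ n, MetricSpace (W n)] [∀ n, CompactSpace (W n)]
    (f : IsomEmb X Z) (F : ∀ n, IsomEmb (W n) Z),
    Tendsto (fun n => Metric.hausdorffEDist (Set.range (F n)) (Set.range f)) atTop (𝓝 0) →
    ∀ (b : σ.obj Z) (a : ∀ n, σ.obj (W n)),
      Tendsto (fun n => σ.map (F n) (a n)) atTop (𝓝 b) → b ∈ Set.range (σ.map f)

/-- For every isometry `f : X → X`: if `τ_f(a) ≤ a` then `τ_f(a) = a`. -/
def PosFunctor.IsometryRigid (τ : PosFunctor.{u, v}) : Prop :=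
  ∀ (X : Type u) [MetricSpace X] [CompactSpace X] (f : IsomEmb X X), Function.Surjective f →
    ∀ a : τ.obj X, τ.map f a ≤ a → τ.map f a = a

/-- The Gromov-Hausdorff-functor distance of `(X, a)` and `(Y, b)`, with values in `[0, ∞]`. -/
def MetFunctor.ghDist (σ : MetFunctor.{u, v}) {X Y : Type u} [MetricSpace X] [CompactSpace X]
    [MetricSpace Y] [CompactSpace Y] (a : σ.obj X) (b : σ.obj Y) : ℝ≥0∞ :=
  ⨅ (Z : Type u) (_ : MetricSpace Z) (_ : CompactSpace Z) (f : IsomEmb X Z) (g : IsomEmb Y Z),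
    max (Metric.hausdorffEDist (Set.range f) (Set.range g)) (edist (σ.map f a) (σ.map g b))

/-- The functor `τ'(X) = X × τ(X)`, with the max product metric. -/
def MetFunctor.pointed (σ : MetFunctor.{u, v}) : MetFunctor.{u, max u v} where
  obj X _ _ := X × σ.obj X
  emetric _ _ _ := inferInstance
  map f p := (f p.1, σ.map f p.2)
  map_isometry f := f.isometry.prodMap (σ.map_isometry f)
  map_id X _ _ a := Prod.ext rfl (σ.map_id X a.2)
  map_comp g f a := Prod.ext rfl (σ.map_comp g f a.2)

variable {τ : PosFunctor.{u, v}}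

/-- The inverse-limit extension `φ(X)`: compatible families `(a_S)` indexed by the compact
subsets `S` of `X`, with `a_S ∈ τ(S)`. -/
structure Phi (τt : TruncFunctor.{u, v} τ) (X : Type u) [MetricSpace X] where
  val : ∀ S : Compacts X, τ.obj S
  compat : ∀ (S T : Compacts X) (h : S ≤ T), τt.trunc (IsomEmb.incl h) (val T) = val S

/-- For compact `X`, an element `a` of `τ(X)` as an element of `φ(X)`: the family of its
truncations to the compact subsets. -/
def Phi.ofCompact (τt : TruncFunctor.{u, v} τ) {X : Type u} [MetricSpace X] [CompactSpace X]
    (a : τ.obj X) : Phi τt X where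
  val S := τt.trunc (IsomEmb.subtype S) a
  compat _ T h := (τt.trunc_comp (IsomEmb.subtype T) (IsomEmb.incl h) a).symm

/-- The preimage of a compact set under an isometry. -/
def preim {X Y : Type*} [MetricSpace X] [MetricSpace Y] (e : X ≃ᵢ Y) (T : Compacts Y) :
    Compacts X :=
  ⟨e ⁻¹' T, e.toHomeomorph.isCompact_preimage.2 T.isCompact⟩

/-- The restriction `e⁻¹(T) → T` of an isometry `e`. -/
def restr {X Y : Type*} [MetricSpace X] [MetricSpace Y] (e : X ≃ᵢ Y) (T : Compacts Y) :
    IsomEmb (preim e T) T :=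
  ⟨fun x => ⟨e x.1, x.2⟩, fun x y => e.isometry x.1 y.1⟩

/-- The family `φ_e(a)` for an isometry `e : X → Y`: its value at a compact `T ⊆ Y` is
`τ_g(a_S)`, where `S = e⁻¹(T)` and `g : S → T` is the restriction of `e`. -/
def Phi.mapVal {τt : TruncFunctor.{u, v} τ} {X Y : Type u} [MetricSpace X] [MetricSpace Y]
    (e : X ≃ᵢ Y) (a : Phi τt X) (T : Compacts Y) : τ.obj T :=
  τ.map (restr e T) (a.val (preim e T))

/-- Tuples `(X, o; a)` with `X` a boundedly-compact metric space, `o ∈ X` and `a ∈ φ(X)`. -/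
structure Tuple (τt : TruncFunctor.{u, v} τ) where
  carrier : Type u
  metric : MetricSpace carrier
  proper : ProperSpace carrier
  base : carrier
  str : Phi τt carrier

attribute [instance] Tuple.metric Tuple.proper

/-- Tuples `(X, o; a)` with `X` a compact metric space, `o ∈ X` and `a ∈ τ(X)`. -/
structure CTuple (τ : PosFunctor.{u, v}) where
  carrier : Type u
  metric : MetricSpace carrier
  compact : CompactSpace carrier
  base : carrier
  str : τ.obj carrier

attribute [instance] CTuple.metric CTuple.compact

/-- The distance `d^c_{τ'}` of compact tuples, where `τ'(X) = X × τ(X)`. -/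
def CTuple.dc (X Y : CTuple τ) : ℝ≥0∞ :=
  τ.pointed.ghDist (X := X.carrier) (Y := Y.carrier) (X.base, X.str) (Y.base, Y.str)

/-- A compact tuple as a boundedly-compact tuple. -/
def CTuple.toTuple (τt : TruncFunctor.{u, v} τ) (X : CTuple τ) : Tuple τt where
  carrier := X.carrier
  metric := X.metric
  proper := inferInstance
  base := X.base
  str := Phi.ofCompact τt X.str

/-- Isomorphism of tuples: a surjective isometry `e` with `e(o_X) = o_Y` and `φ_e(a_X) = a_Y`. -/
def Tuple.Iso {τt : TruncFunctor.{u, v} τ} (X Y : Tuple τt) : Prop :=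
  ∃ e : X.carrier ≃ᵢ Y.carrier, e X.base = Y.base ∧
    ∀ T : Compacts Y.carrier, X.str.mapVal e T = Y.str.val T

lemma Phi.map_val_of_eq {τt : TruncFunctor.{u, v} τ} {X : Type u} [MetricSpace X] (a : Phi τt X)
    {S T : Compacts X} (h : S = T) (f : IsomEmb S T) (hf : ∀ x, (f x : X) = x) :
    τ.map f (a.val S) = a.val T := by
  subst h
  have : f = IsomEmb.id S := by
    obtain ⟨f, hf'⟩ := f
    have : f = fun x => x := funext fun x => Subtype.ext (hf x)
    subst this
    rfl
  rw [this, τ.map_id]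

lemma Tuple.iso_equivalence (τt : TruncFunctor.{u, v} τ) :
    Equivalence (Tuple.Iso (τt := τt)) where
  refl X := ⟨IsometryEquiv.refl _, rfl, fun _ =>
    X.str.map_val_of_eq rfl _ (fun _ => rfl)⟩
  symm := by
    rintro X Y ⟨e, he, h⟩
    refine ⟨e.symm, by rw [← he, e.symm_apply_apply], fun S => ?_⟩
    unfold Phi.mapVal
    rw [← h (preim e.symm S)]
    unfold Phi.mapVal
    rw [← τ.map_comp]
    refine X.str.map_val_of_eq ?_ _ (fun x => e.symm_apply_apply _)
    ext x
    change e.symm (e x) ∈ S ↔ x ∈ S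
    rw [e.symm_apply_apply]
  trans := by
    rintro X Y Z ⟨e, he, h⟩ ⟨e', he', h'⟩
    refine ⟨e.trans e', by rw [IsometryEquiv.trans_apply, he, he'], fun T => ?_⟩
    rw [← h' T]
    unfold Phi.mapVal
    rw [← h (preim e' T)]
    unfold Phi.mapVal
    rw [← τ.map_comp]
    rfl

/-- Isomorphism as a setoid on tuples. -/
def Tuple.setoid (τt : TruncFunctor.{u, v} τ) : Setoid (Tuple τt) :=
  ⟨Tuple.Iso, Tuple.iso_equivalence τt⟩

/-- The space `𝒞'` of isomorphism classes of tuples `(X, o; a)`. -/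
def CPrime (τt : TruncFunctor.{u, v} τ) : Type (max (u + 1) v) := Quotient (Tuple.setoid τt)

/-- The isomorphism class of a tuple. -/
def CPrime.mk {τt : TruncFunctor.{u, v} τ} (X : Tuple τt) : CPrime τt :=
  Quotient.mk (Tuple.setoid τt) X

/-- Compact tuples `(S, o; c)` living on a compact subset `S ∋ o` of the underlying space of
`X = (X, o; a)`, with `c ∈ τ(S)`. -/
structure SubTuple {τt : TruncFunctor.{u, v} τ} (X : Tuple τt) where
  set : Compacts X.carrier
  base_mem : X.base ∈ set
  str : τ.obj set

namespace SubTuple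

variable {τt : TruncFunctor.{u, v} τ} {X : Tuple τt}

/-- A sub-tuple is a compact tuple. -/
def toC (A : SubTuple X) : CTuple τ where
  carrier := A.set
  metric := inferInstance
  compact := inferInstance
  base := ⟨X.base, A.base_mem⟩
  str := A.str

/-- `(S, o; c) ⪯ (X, o; a)`: `c` is at most the truncation `a_S` of `a` to `S`. -/
def LEWhole (A : SubTuple X) : Prop := A.str ≤ X.str.val A.set

/-- `(S, o; c) ⪯ (S', o; c')`: `S ⊆ S'` and `c` is at most the truncation of `c'` to `S`. -/
def Preceq (A B : SubTuple X) : Prop :=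
  ∃ h : A.set ≤ B.set, A.str ≤ τt.trunc (IsomEmb.incl h) B.str

end SubTuple

/-- The truncated ball `X^{(r)}`: the closed ball of radius `r ≥ 0` around the origin, with the
truncation of the additional structure to it. -/
def Tuple.ball {τt : TruncFunctor.{u, v} τ} (X : Tuple τt) (r : ℝ) (hr : 0 ≤ r) : SubTuple X where
  set := ⟨Metric.closedBall X.base r, isCompact_closedBall X.base r⟩
  base_mem := Metric.mem_closedBall_self hr
  str := X.str.val _

/-- For compact `𝒳, 𝒴` and every `𝒳' ⪯ 𝒳` there is `𝒴' ⪯ 𝒴` with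
`d^c(𝒳', 𝒴') ≤ d^c(𝒳, 𝒴)`. -/
def SubsetAssumption (τt : TruncFunctor.{u, v} τ) : Prop :=
  ∀ (X Y : CTuple τ) (A : SubTuple (X.toTuple τt)), A.LEWhole →
    ∃ B : SubTuple (Y.toTuple τt), B.LEWhole ∧ A.toC.dc B.toC ≤ X.dc Y

/-- If moreover `𝒳^{(r)} ⪯ 𝒳'`, where `r ≥ 2ε` and `ε = d^c(𝒳, 𝒴)`, then `𝒴'` can be chosen
with `𝒴^{(r - 2ε)} ⪯ 𝒴'`. -/
def BallSubsetAssumption (τt : TruncFunctor.{u, v} τ) : Prop :=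
  ∀ (X Y : CTuple τ) (ε r : ℝ) (hr : 0 ≤ r) (hεr : 2 * ε ≤ r), 0 ≤ ε →
    X.dc Y = ENNReal.ofReal ε →
    ∀ A : SubTuple (X.toTuple τt), ((X.toTuple τt).ball r hr).Preceq A → A.LEWhole →
      ∃ B : SubTuple (Y.toTuple τt),
        ((Y.toTuple τt).ball (r - 2 * ε) (sub_nonneg.2 hεr)).Preceq B ∧ B.LEWhole ∧
          A.toC.dc B.toC ≤ X.dc Y

lemma inv_sub_self_nonneg {ε : ℝ} (h : ε ∈ Set.Ioc (0 : ℝ) 1) : 0 ≤ 1 / ε - ε := by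
  have := one_le_one_div h.1 h.2
  linarith [h.2]

/-- `a_ε(X, Y)`: the infimum of `d^c(X^{(1/ε)}, Y')` over the compact `Y'` with
`Y^{(1/ε - ε)} ⪯ Y' ⪯ Y`. -/
def aDist {τt : TruncFunctor.{u, v} τ} (ε : ℝ) (hε : ε ∈ Set.Ioc (0 : ℝ) 1) (X Y : Tuple τt) :
    ℝ≥0∞ :=
  ⨅ (B : SubTuple Y) (_ : (Y.ball (1 / ε - ε) (inv_sub_self_nonneg hε)).Preceq B)
    (_ : B.LEWhole), (X.ball (1 / ε) (one_div_pos.2 hε.1).le).toC.dc B.toC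

/-- `d(X, Y) = inf {ε ∈ (0, 1] : a_ε(X, Y) ∨ a_ε(Y, X) < ε / 2}`, where `inf ∅ = 1`: as the set
lies in `(0, 1]`, this is the infimum after adding the point `1`. -/
def tupleDist {τt : TruncFunctor.{u, v} τ} (X Y : Tuple τt) : ℝ :=
  sInf (insert 1 {ε : ℝ | ∃ hε : ε ∈ Set.Ioc (0 : ℝ) 1,
    max (aDist ε hε X Y) (aDist ε hε Y X) < ENNReal.ofReal (ε / 2)})

end GHFunctor

end

/-! The triangle inequality rests on `BallSubsetAssumption`. Suppose `1/ε`-balls of `X` are matched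
in `Y` with error `< ε/2`, and `1/δ`-balls of `Y` in `W` with error `< δ/2`, where `ε + δ ≤ 1`. Put
`r = 1/(ε+δ)`. Restricting the first match to the `r`-ball of `X` yields a piece of `Y` that
contains the `(r-ε)`-ball and lies in the `(r+ε)`-ball, hence in the `1/δ`-ball. Restricting the
second match to that piece yields a piece of `W` containing the `(r-ε-δ)`-ball, at distance `<
(ε+δ)/2` (`aDist_triangle`). Invariance under isomorphism then follows, since isomorphic tuples are
at distance `0`.

For definiteness, let the distance of `X` and `Y` be `0`. By `SubsetAssumption`, each ball of `X` is
a limit of compact pieces below one fixed ball of `Y`. Compactness of the hyperspace and of the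
cones gives a limit piece, whose structure lives on the limit set by `LimitsInImage`; it is at
distance `0` from the ball of `X`, hence related to it by an isometry
(`exists_map_le_of_tendsto_ghDist`). That step uses a compact amalgam of infinitely many spaces
(`exists_common_space`) and continuity of `τ`. A diagonal argument turns the embeddings of balls
into one embedding of `X` below `Y` (`exists_isometry_map_le`). By symmetry `Y` embeds below `X`. On
each ball the composite is a surjective isometry that does not increase the structure, so rigidity
makes all inequalities equalities (`iso_of_tupleDist_eq_zero`). -/

noncomputable section

namespace GHFunctor

/-! ### Compactness and isometries -/

section Topology

/-- A finite subcover of `K` already covers all but finitely many of the `R n`. -/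
lemma isCompact_union_iUnion {E : Type*} [TopologicalSpace E] {K : Set E} {R : ℕ → Set E}
    (hK : IsCompact K) (hR : ∀ n, IsCompact (R n))
    (h : ∀ U, IsOpen U → K ⊆ U → ∀ᶠ n in atTop, R n ⊆ U) : IsCompact (K ∪ ⋃ n, R n) := by
  refine isCompact_of_finite_subcover fun {ι} U hU hcov => ?_
  obtain ⟨t, ht⟩ := hK.elim_finite_subcover U hU (Set.subset_union_left.trans hcov)
  obtain ⟨N, hN⟩ := eventually_atTop.1
    (h (⋃ i ∈ t, U i) (isOpen_biUnion fun i _ => hU i) ht)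
  have hfin : IsCompact (⋃ n ∈ Finset.range N, R n) :=
    (Finset.range N).isCompact_biUnion fun n _ => hR n
  obtain ⟨s, hs⟩ := hfin.elim_finite_subcover U hU
    ((Set.iUnion₂_subset fun n _ => Set.subset_iUnion R n).trans
      (Set.subset_union_right.trans hcov))
  classical
  refine ⟨t ∪ s, ?_⟩
  rw [Finset.set_biUnion_union]
  refine Set.union_subset (ht.trans Set.subset_union_left) (Set.iUnion_subset fun n => ?_)
  rcases lt_or_ge n N with hn | hn
  · exact (Set.subset_biUnion_of_mem (u := R) (Finset.mem_coe.2 (Finset.mem_range.2 hn))).trans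
      (hs.trans Set.subset_union_right)
  · exact (hN n hn).trans Set.subset_union_left

/-- An isometric self-embedding of a compact metric space is surjective. -/
lemma surjective_of_isometry {X : Type*} [MetricSpace X] [CompactSpace X] {f : X → X}
    (hf : Isometry f) : Function.Surjective f := by
  intro x
  by_contra hx
  have hx' : x ∉ Set.range f := hx
  have hcl : IsClosed (Set.range f) := (isCompact_range hf.continuous).isClosed
  obtain ⟨ε, hε, hball⟩ := Metric.isOpen_iff.1 hcl.isOpen_compl x hx'
  have hsep : ∀ y, ε ≤ dist x (f y) := fun y => by
    by_contra! hlt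
    exact hball (Metric.mem_ball'.2 hlt) ⟨y, rfl⟩
  have hiter : ∀ m, Isometry f^[m] := fun m => by
    induction m with
    | zero => exact isometry_id
    | succ m ih => exact ih.comp hf
  -- The orbit of a point `x` missed by `f` is `ε`-separated, so it has no Cauchy subsequence.
  have hit : ∀ m k, ε ≤ dist (f^[m] x) (f^[m + (k + 1)] x) := fun m k => by
    rw [Function.iterate_add_apply, (hiter m).dist_eq, Function.iterate_succ_apply']
    exact hsep _
  obtain ⟨a, -, φ, hφ, ha⟩ := isCompact_univ.tendsto_subseq (x := fun n => f^[n] x)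
    fun _ => Set.mem_univ _
  obtain ⟨N, hN⟩ := Metric.cauchySeq_iff.1 ha.cauchySeq ε hε
  have h1 := hN N le_rfl (N + 1) (Nat.le_succ N)
  obtain ⟨k, hk⟩ := Nat.exists_eq_add_of_lt (hφ (Nat.lt_succ_self N))
  have h2 := hit (φ N) k
  simp only [Function.comp_apply] at h1
  rw [show φ (N + 1) = φ N + (k + 1) by omega] at h1
  linarith

/-- A sequence of maps which are eventually isometric on each pair of points and whose values at
each point stay in a compact set has a subsequence converging pointwise to an isometry. -/
lemma exists_subseq_tendsto_isometry {X Y : Type*} [MetricSpace X] [SeparableSpace X]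
    [MetricSpace Y] [CompleteSpace Y] (g : ℕ → X → Y)
    (hg : ∀ x x', ∀ᶠ n in atTop, dist (g n x) (g n x') = dist x x')
    (hK : ∀ x, ∃ K : Set Y, IsCompact K ∧ ∀ n, g n x ∈ K) :
    ∃ φ : ℕ → ℕ, StrictMono φ ∧ ∃ G : X → Y, Isometry G ∧
      ∀ x, Tendsto (fun n => g (φ n) x) atTop (𝓝 (G x)) := by
  rcases isEmpty_or_nonempty X with hX | hX
  · exact ⟨id, strictMono_id, fun x => (hX.false x).elim, fun x => (hX.false x).elim,
      fun x => (hX.false x).elim⟩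
  choose K hKc hKm using hK
  -- Sequential compactness of the countable product replaces an explicit diagonal argument on a
  -- dense sequence; the isometry property then spreads convergence to every point.
  obtain ⟨a, -, φ, hφ, ha⟩ := (isCompact_univ_pi fun k => hKc (denseSeq X k)).tendsto_subseq
    (x := fun n k => g n (denseSeq X k)) fun n k _ => hKm _ n
  have hconv : ∀ k, Tendsto (fun n => g (φ n) (denseSeq X k)) atTop (𝓝 (a k)) := fun k =>
    (tendsto_pi_nhds.1 ha) k
  have hcau : ∀ x, CauchySeq fun n => g (φ n) x := fun x => by
    refine Metric.cauchySeq_iff.2 fun ε hε => ?_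
    obtain ⟨k, hk⟩ := (denseRange_denseSeq X).exists_dist_lt x (show 0 < ε / 3 by linarith)
    obtain ⟨N, hN⟩ := Metric.cauchySeq_iff.1 (hconv k).cauchySeq (ε / 3) (by linarith)
    obtain ⟨N', hN'⟩ := eventually_atTop.1 (hφ.tendsto_atTop.eventually (hg x (denseSeq X k)))
    refine ⟨max N N', fun m hm n hn => ?_⟩
    have h1 := hN m (le_of_max_le_left hm) n (le_of_max_le_left hn)
    have h2 := hN' m (le_of_max_le_right hm)
    have h3 := hN' n (le_of_max_le_right hn)
    have h4 := dist_triangle4 (g (φ m) x) (g (φ m) (denseSeq X k)) (g (φ n) (denseSeq X k))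
      (g (φ n) x)
    rw [dist_comm (g (φ n) (denseSeq X k))] at h4
    linarith
  choose G hG using fun x => cauchySeq_tendsto_of_complete (hcau x)
  refine ⟨φ, hφ, G, Isometry.of_dist_eq fun x y => ?_, hG⟩
  exact tendsto_nhds_unique ((hG x).dist (hG y))
    (tendsto_const_nhds.congr' ((hφ.tendsto_atTop.eventually (hg x y)).mono fun n hn => hn.symm))

end Topology

/-! ### Gluing metric spaces along a common subspace -/

section Amalgam

variable {ι W P : Type*} {Z : ι → Type*} [∀ n, MetricSpace (Z n)]

open Classical in
/-- The distance on `ι × W` for a family of maps `k n : W → Z n` inducing the same distance on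
`P`: two points in different sheets are joined through `P`. -/
def amalgamDist (k : ∀ n, W → Z n) (i : P → W) (x y : ι × W) : ℝ :=
  if x.1 = y.1 then dist (k x.1 x.2) (k x.1 y.2) else
    ⨅ p, (dist (k x.1 x.2) (k x.1 (i p)) + dist (k y.1 (i p)) (k y.1 y.2))

variable (k : ∀ n, W → Z n) (i : P → W)

lemma amalgamDist_same (n : ι) (w w' : W) :
    amalgamDist k i (n, w) (n, w') = dist (k n w) (k n w') := if_pos rfl

lemma amalgamDist_ne {n m : ι} (h : n ≠ m) (w w' : W) :
    amalgamDist k i (n, w) (m, w') =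
      ⨅ p, (dist (k n w) (k n (i p)) + dist (k m (i p)) (k m w')) := if_neg h

lemma amalgamDist_le {n m : ι} (h : n ≠ m) (w w' : W) (p : P) :
    amalgamDist k i (n, w) (m, w') ≤ dist (k n w) (k n (i p)) + dist (k m (i p)) (k m w') := by
  rw [amalgamDist_ne k i h]
  exact ciInf_le ⟨0, by rintro _ ⟨p, rfl⟩; positivity⟩ p

lemma amalgamDist_comm (x y : ι × W) : amalgamDist k i x y = amalgamDist k i y x := by
  obtain ⟨n, w⟩ := x
  obtain ⟨m, w'⟩ := y
  by_cases h : n = m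
  · subst h
    rw [amalgamDist_same, amalgamDist_same, dist_comm]
  · rw [amalgamDist_ne k i h, amalgamDist_ne k i (Ne.symm h)]
    congr 1
    ext p
    rw [add_comm, dist_comm, dist_comm (k n w)]

lemma amalgamDist_triangle [Nonempty P]
    (h : ∀ n m p p', dist (k n (i p)) (k n (i p')) = dist (k m (i p)) (k m (i p')))
    (x y z : ι × W) : amalgamDist k i x z ≤ amalgamDist k i x y + amalgamDist k i y z := by
  obtain ⟨n, w⟩ := x
  obtain ⟨m, w'⟩ := y
  obtain ⟨l, w''⟩ := z
  by_cases hnm : n = m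
  · subst hnm
    by_cases hnl : n = l
    · subst hnl
      simp only [amalgamDist_same]
      exact dist_triangle _ _ _
    · rw [amalgamDist_same, amalgamDist_ne k i hnl w']
      rw [← sub_le_iff_le_add']
      refine le_ciInf fun p => ?_
      have h1 := amalgamDist_le k i hnl w w'' p
      have h2 := dist_triangle (k n w) (k n w') (k n (i p))
      linarith
  · by_cases hml : m = l
    · subst hml
      rw [amalgamDist_same, amalgamDist_ne k i hnm w w', ← sub_le_iff_le_add]
      refine le_ciInf fun p => ?_
      have h1 := amalgamDist_le k i hnm w w'' p
      have h2 := dist_triangle (k m (i p)) (k m w') (k m w'')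
      linarith
    · rw [amalgamDist_ne k i hnm, amalgamDist_ne k i hml]
      refine le_ciInf_add_ciInf fun p q => ?_
      have h1 := dist_triangle4 (k m (i p)) (k m w') (k m w') (k m (i q))
      have h2 := dist_self (k m w')
      -- The path enters sheet `m` at `p` and leaves it at `q`. By `h` the segment between them can
      -- be moved to sheet `n`, so the detour is not needed; it may also end in the sheet where it
      -- began.
      have h3 : amalgamDist k i (n, w) (l, w'') ≤ dist (k n w) (k n (i p)) +
          dist (k m (i p)) (k m (i q)) + dist (k l (i q)) (k l w'') := by
        by_cases hnl : n = l
        · subst hnl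
          rw [amalgamDist_same, h m n]
          exact dist_triangle4 _ _ _ _
        · have h1 := amalgamDist_le k i hnl w w'' q
          have h2 := dist_triangle (k n w) (k n (i p)) (k n (i q))
          rw [h m n]
          linarith
      linarith

/-- The amalgam of the images of the maps `k n : W → Z n` along `P`, as a metric space. -/
lemma exists_amalgam {ι : Type} {W P : Type u} {Z : ι → Type u} [∀ n, MetricSpace (Z n)] [Nonempty P]
    (k : ∀ n, W → Z n) (i : P → W)
    (h : ∀ n m p p', dist (k n (i p)) (k n (i p')) = dist (k m (i p)) (k m (i p'))) :
    ∃ (E : Type u) (_ : MetricSpace E) (π : ι → W → E), (∀ x, ∃ n w, π n w = x) ∧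
      ∀ n w m w', dist (π n w) (π m w') = amalgamDist k i (n, w) (m, w') := by
  let M : PseudoMetricSpace (ι × W) :=
    { dist := amalgamDist k i
      dist_self := fun x => (amalgamDist_same k i x.1 x.2 x.2).trans (dist_self _)
      dist_comm := amalgamDist_comm k i
      dist_triangle := amalgamDist_triangle k i h }
  let _ : TopologicalSpace (ι × W) := M.toUniformSpace.toTopologicalSpace
  refine ⟨@SeparationQuotient (ι × W) M.toUniformSpace.toTopologicalSpace,
    @SeparationQuotient.instMetricSpace _ M, fun n w => SeparationQuotient.mk (n, w),
    fun x => ?_, fun n w m w' => rfl⟩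
  obtain ⟨⟨n, w⟩, rfl⟩ := SeparationQuotient.surjective_mk x
  exact ⟨n, w, rfl⟩

end Amalgam

/-- If `P` and `Q` are embedded in metric spaces `Z n` and the Hausdorff distance between their
images tends to `0`, then all the unions of their images embed compatibly in one compact space. -/
lemma exists_common_space {P Q : Type u} [MetricSpace P] [CompactSpace P] [Nonempty P]
    [MetricSpace Q] [CompactSpace Q] (Z : ℕ → Type u) [∀ n, MetricSpace (Z n)]
    (f : ∀ n, IsomEmb P (Z n)) (g : ∀ n, IsomEmb Q (Z n))
    (hfg : ∀ ε > 0, ∀ᶠ n in atTop, ∀ q, ∃ p, dist (g n q) (f n p) < ε) :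
    ∃ (E : Type u) (_ : MetricSpace E) (_ : CompactSpace E) (F : IsomEmb P E)
      (G : ℕ → IsomEmb Q E)
      (J : ∀ n, IsomEmb ↥(Set.range (f n) ∪ Set.range (g n)) E),
      (∀ n p, J n ⟨f n p, Or.inl ⟨p, rfl⟩⟩ = F p) ∧
      (∀ n q, J n ⟨g n q, Or.inr ⟨q, rfl⟩⟩ = G n q) := by
  -- Only the images of `P` and `Q` are glued: infinitely many full spaces `Z n` need not have a
  -- compact amalgam.
  let k : ∀ n, P ⊕ Q → Z n := fun n => Sum.elim (f n) (g n)
  have hk : ∀ n m p p', dist (k n (Sum.inl p)) (k n (Sum.inl p')) =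
      dist (k m (Sum.inl p)) (k m (Sum.inl p')) := fun n m p p' => by
    simp only [k, Sum.elim_inl, (f _).isometry.dist_eq]
  obtain ⟨E, _, π, hsurj, hdist⟩ := exists_amalgam k Sum.inl hk
  have hπ : ∀ n w w', dist (π n w) (π n w') = dist (k n w) (k n w') := fun n w w' =>
    (hdist n w n w').trans (amalgamDist_same k Sum.inl n w w')
  have hglue : ∀ n m p, π n (Sum.inl p) = π m (Sum.inl p) := fun n m p => by
    rw [← dist_le_zero, hdist]
    by_cases hnm : n = m
    · subst hnm
      exact (amalgamDist_same k Sum.inl n _ _).le.trans (dist_self _).le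
    · refine (amalgamDist_le k Sum.inl hnm _ _ p).trans ?_
      rw [dist_self, dist_self, add_zero]
  let F : IsomEmb P (E) :=
    ⟨fun p => π 0 (Sum.inl p), Isometry.of_dist_eq fun p p' => by
      rw [hπ]; exact (f 0).isometry.dist_eq _ _⟩
  let G : ∀ n : ℕ, IsomEmb Q (E) := fun n =>
    ⟨fun q => π n (Sum.inr q), Isometry.of_dist_eq fun p p' => by
      rw [hπ]; exact (g n).isometry.dist_eq _ _⟩
  have hr : ∀ n (z : ↥(Set.range (f n) ∪ Set.range (g n))), ∃ w, k n w = z := by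
    rintro n ⟨_, ⟨p, rfl⟩ | ⟨q, rfl⟩⟩
    · exact ⟨Sum.inl p, rfl⟩
    · exact ⟨Sum.inr q, rfl⟩
  choose r hr using hr
  -- A point may lie in both images; its class in `E` does not depend on the chosen preimage.
  have hJ : ∀ n z w, k n w = z.1 → π n (r n z) = π n w := fun n z w hw => by
    rw [← dist_le_zero, hπ, hr, hw, dist_self]
  have huniv : Set.range F ∪ ⋃ n, Set.range (G n) = Set.univ := by
    refine Set.eq_univ_of_forall fun x => ?_
    obtain ⟨n, p | q, rfl⟩ := hsurj x
    · exact Or.inl ⟨p, hglue 0 n p⟩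
    · exact Or.inr (Set.mem_iUnion.2 ⟨n, q, rfl⟩)
  -- The copies of `Q` eventually enter every thickening of the common copy of `P`.
  have hcomp : CompactSpace (E) := by
    rw [← isCompact_univ_iff, ← huniv]
    have hK := isCompact_range F.isometry.continuous
    refine isCompact_union_iUnion hK (fun n => isCompact_range (G n).isometry.continuous)
      fun U hU hKU => ?_
    obtain ⟨δ, hδ, hδU⟩ := hK.exists_thickening_subset_open hU hKU
    filter_upwards [hfg δ hδ] with n hn
    rintro _ ⟨q, rfl⟩
    obtain ⟨p, hp⟩ := hn q
    refine hδU (Metric.mem_thickening_iff.2 ⟨F p, ⟨p, rfl⟩, ?_⟩)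
    change dist (π n (Sum.inr q)) (π 0 (Sum.inl p)) < δ
    rw [hglue 0 n, hπ]
    exact hp
  refine ⟨E, inferInstance, hcomp, F, G, fun n => ⟨fun z => π n (r n z),
    Isometry.of_dist_eq fun z z' => by rw [hπ, hr, hr]; rfl⟩, fun n p => ?_, fun n q => ?_⟩
  · exact (hJ n _ (Sum.inl p) rfl).trans (hglue _ _ _)
  · exact hJ n _ (Sum.inr q) rfl

lemma compactSpace_glueSpace {X Y Z : Type*} [Nonempty Z] [MetricSpace Z] [MetricSpace X]
    [MetricSpace Y] [CompactSpace X] [CompactSpace Y] {Φ : Z → X} {Ψ : Z → Y} (hΦ : Isometry Φ)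
    (hΨ : Isometry Ψ) : CompactSpace (Metric.GlueSpace hΦ hΨ) := by
  have : Set.range (Metric.toGlueL hΦ hΨ) ∪ Set.range (Metric.toGlueR hΦ hΨ) = Set.univ := by
    refine Set.eq_univ_of_forall fun x => ?_
    obtain ⟨x | y, rfl⟩ := Quotient.exists_rep x
    · exact Or.inl ⟨x, rfl⟩
    · exact Or.inr ⟨y, rfl⟩
  rw [← isCompact_univ_iff, ← this]
  exact (isCompact_range (Metric.toGlueL_isometry hΦ hΨ).continuous).union
    (isCompact_range (Metric.toGlueR_isometry hΦ hΨ).continuous)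

lemma IsomEmb.ext {X Y : Type*} [MetricSpace X] [MetricSpace Y] {f g : IsomEmb X Y}
    (h : ∀ x, f x = g x) : f = g := by
  cases f
  cases g
  congr 1
  exact funext h

/-! ### The Gromov-Hausdorff-functor distance -/

namespace MetFunctor

variable (σ : MetFunctor.{u, v}) {X Y Z W : Type u} [MetricSpace X] [CompactSpace X]
  [MetricSpace Y] [CompactSpace Y] [MetricSpace Z] [CompactSpace Z] [MetricSpace W]
  [CompactSpace W]

lemma edist_map (f : IsomEmb X Y) (a b : σ.obj X) : edist (σ.map f a) (σ.map f b) = edist a b :=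
  σ.map_isometry f a b

lemma ghDist_le (a : σ.obj X) (b : σ.obj Y) (f : IsomEmb X Z) (g : IsomEmb Y Z) :
    σ.ghDist a b ≤
      max (Metric.hausdorffEDist (Set.range f) (Set.range g)) (edist (σ.map f a) (σ.map g b)) :=
  iInf_le_of_le Z <| iInf_le_of_le _ <| iInf_le_of_le _ <| iInf_le_of_le f <| iInf_le _ g

lemma exists_of_ghDist_lt {a : σ.obj X} {b : σ.obj Y} {r : ℝ≥0∞} (h : σ.ghDist a b < r) :
    ∃ (Z : Type u) (_ : MetricSpace Z) (_ : CompactSpace Z) (f : IsomEmb X Z) (g : IsomEmb Y Z),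
      Metric.hausdorffEDist (Set.range f) (Set.range g) < r ∧
        edist (σ.map f a) (σ.map g b) < r := by
  simpa only [ghDist, iInf_lt_iff, max_lt_iff] using h

lemma ghDist_comm (a : σ.obj X) (b : σ.obj Y) : σ.ghDist a b = σ.ghDist b a := by
  have key : ∀ {X Y : Type u} [MetricSpace X] [CompactSpace X] [MetricSpace Y] [CompactSpace Y]
      (a : σ.obj X) (b : σ.obj Y), σ.ghDist a b ≤ σ.ghDist b a := by
    intro X Y _ _ _ _ a b
    refine le_of_forall_gt fun r hr => ?_
    obtain ⟨Z, _, _, f, g, h1, h2⟩ := σ.exists_of_ghDist_lt hr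
    rw [Metric.hausdorffEDist_comm] at h1
    rw [edist_comm] at h2
    exact (σ.ghDist_le a b g f).trans_lt (max_lt h1 h2)
  exact le_antisymm (key a b) (key b a)

lemma ghDist_triangle [Nonempty Y] (a : σ.obj X) (b : σ.obj Y) (c : σ.obj W) :
    σ.ghDist a c ≤ σ.ghDist a b + σ.ghDist b c := by
  refine ENNReal.le_of_forall_pos_le_add fun η hη hlt => ?_
  have hη' : (η / 2 : ℝ≥0∞) ≠ 0 := by simpa using hη.ne'
  obtain ⟨h1, h2⟩ := ENNReal.add_lt_top.1 hlt
  obtain ⟨Z₁, _, _, f₁, g₁, hH₁, hd₁⟩ :=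
    σ.exists_of_ghDist_lt (ENNReal.lt_add_right h1.ne hη')
  obtain ⟨Z₂, _, _, f₂, g₂, hH₂, hd₂⟩ :=
    σ.exists_of_ghDist_lt (ENNReal.lt_add_right h2.ne hη')
  have := compactSpace_glueSpace g₁.isometry f₂.isometry
  let L : IsomEmb Z₁ (Metric.GlueSpace g₁.isometry f₂.isometry) :=
    ⟨_, Metric.toGlueL_isometry _ _⟩
  let R : IsomEmb Z₂ (Metric.GlueSpace g₁.isometry f₂.isometry) :=
    ⟨_, Metric.toGlueR_isometry _ _⟩
  -- In the space glued along `Y`, both copies of `Y`, and so both images of `b`, agree and serve as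
  -- the middle term.
  have hLR : L.comp g₁ = R.comp f₂ :=
    IsomEmb.ext (congrFun (Metric.toGlue_commute g₁.isometry f₂.isometry))
  have hsum : (σ.ghDist a b + (η / 2 : ℝ≥0∞)) + (σ.ghDist b c + (η / 2 : ℝ≥0∞)) =
      σ.ghDist a b + σ.ghDist b c + η := by
    rw [add_add_add_comm, ENNReal.add_halves]
  have hrange : ∀ {A B C : Type u} [MetricSpace A] [MetricSpace B] [MetricSpace C]
      (g : IsomEmb B C) (f : IsomEmb A B), Set.range (g.comp f) = g '' Set.range f :=
    fun g f => Set.range_comp g f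
  refine (σ.ghDist_le a c (L.comp f₁) (R.comp g₂)).trans (max_le ?_ ?_)
  · rw [← hsum]
    refine (Metric.hausdorffEDist_triangle (t := Set.range (L.comp g₁))).trans
      (add_le_add ?_ ?_)
    · rw [hrange, hrange, Metric.hausdorffEDist_image L.isometry]
      exact hH₁.le
    · rw [hLR, hrange, hrange, Metric.hausdorffEDist_image R.isometry]
      exact hH₂.le
  · rw [← hsum]
    refine (edist_triangle _ (σ.map (L.comp g₁) b) _).trans (add_le_add ?_ ?_)
    · rw [σ.map_comp, σ.map_comp, σ.edist_map]
      exact hd₁.le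
    · rw [hLR, σ.map_comp, σ.map_comp, σ.edist_map]
      exact hd₂.le

lemma ghDist_eq_zero_of_surjective (e : IsomEmb X Y) (he : Function.Surjective e) {a : σ.obj X}
    {b : σ.obj Y} (h : σ.map e a = b) : σ.ghDist a b = 0 := by
  refine le_antisymm ((σ.ghDist_le a b e (IsomEmb.id Y)).trans (max_le ?_ ?_)) bot_le
  · have : Set.range (IsomEmb.id Y) = Set.univ := Set.range_id
    rw [he.range_eq, this, Metric.hausdorffEDist_self]
  · rw [σ.map_id, h, edist_self]

/-- Two elements at distance `0` are related by an isometry. -/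
lemma exists_map_eq_of_ghDist_eq_zero [Nonempty X] (hcont : σ.PointwiseContinuous) {a : σ.obj X}
    {b : σ.obj Y} (h : σ.ghDist a b = 0) :
    ∃ e : IsomEmb Y X, σ.map e b = a := by
  have hpos : ∀ n : ℕ, σ.ghDist a b < ((n : ℝ≥0∞) + 1)⁻¹ := fun n => by
    rw [h]
    exact ENNReal.inv_pos.2 (by finiteness)
  choose Z hZm hZc f g hH hd using fun n => σ.exists_of_ghDist_lt (hpos n)
  have hlim : Tendsto (fun n : ℕ => ((n : ℝ≥0∞) + 1)⁻¹) atTop (𝓝 0) := by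
    have := (tendsto_add_atTop_iff_nat 1).2 ENNReal.tendsto_inv_nat_nhds_zero
    simpa using this
  obtain ⟨E, _, _, F, G, J, hJF, hJG⟩ := exists_common_space Z f g fun ε hε => by
    filter_upwards [hlim.eventually (gt_mem_nhds (ENNReal.ofReal_pos.2 hε))] with n hn q
    have := (hH n).trans hn
    rw [Metric.hausdorffEDist_comm] at this
    obtain ⟨_, ⟨p, rfl⟩, hp⟩ := Metric.exists_edist_lt_of_hausdorffEDist_lt (Set.mem_range_self q) this
    rw [edist_dist] at hp
    exact ⟨p, (ENNReal.ofReal_lt_ofReal_iff hε).1 hp⟩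
  -- Since `σ` acts by isometric embeddings, the distance between the images of `a` and `b` is the
  -- same in `σ(Z n)`, in `σ` of the union of the two images, and in `σ(E)`.
  have hclose : ∀ n, edist (σ.map F a) (σ.map (G n) b) < ((n : ℝ≥0∞) + 1)⁻¹ := fun n => by
    have hcomp : CompactSpace ↥(Set.range (f n) ∪ Set.range (g n)) :=
      isCompact_iff_compactSpace.1 ((isCompact_range (f n).isometry.continuous).union
        (isCompact_range (g n).isometry.continuous))
    let f' : IsomEmb X ↥(Set.range (f n) ∪ Set.range (g n)) :=
      ⟨fun p => ⟨f n p, Or.inl ⟨p, rfl⟩⟩, fun x y => (f n).isometry x y⟩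
    let g' : IsomEmb Y ↥(Set.range (f n) ∪ Set.range (g n)) :=
      ⟨fun p => ⟨g n p, Or.inr ⟨p, rfl⟩⟩, fun x y => (g n).isometry x y⟩
    let i : IsomEmb ↥(Set.range (f n) ∪ Set.range (g n)) (Z n) :=
      ⟨Subtype.val, isometry_subtype_coe⟩
    have h1 : (J n).comp f' = F := IsomEmb.ext (hJF n)
    have h2 : (J n).comp g' = G n := IsomEmb.ext (hJG n)
    have : edist (σ.map (i.comp f') a) (σ.map (i.comp g') b) < ((n : ℝ≥0∞) + 1)⁻¹ := hd n
    rw [σ.map_comp, σ.map_comp, σ.edist_map] at this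
    rwa [← h1, ← h2, σ.map_comp, σ.map_comp, σ.edist_map]
  obtain ⟨φ, hφ, γ, hγ, hlimg⟩ := exists_subseq_tendsto_isometry (fun n => (G n : Y → E))
    (fun x x' => Eventually.of_forall fun n => (G n).isometry.dist_eq x x')
    fun x => ⟨Set.univ, isCompact_univ, fun n => Set.mem_univ _⟩
  -- `G (φ n) y` approaches the closed set `F(X)`, so the limit embedding `γ` factors through `F`.
  have hmem : ∀ y, ∃ p, F p = γ y := fun y => by
    have hcl : IsClosed (Set.range F) := (isCompact_range F.isometry.continuous).isClosed
    change γ y ∈ Set.range F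
    rw [← hcl.closure_eq]
    refine Metric.mem_closure_iff.2 fun ε hε => ?_
    obtain ⟨n, hn1, hn2⟩ := (((Metric.tendsto_nhds.1 (hlimg y)) (ε / 2) (half_pos hε)).and
      (hφ.tendsto_atTop.eventually (hlim.eventually
        (gt_mem_nhds (ENNReal.ofReal_pos.2 (half_pos hε)))))).exists
    have := (hH (φ n)).trans hn2
    rw [Metric.hausdorffEDist_comm] at this
    obtain ⟨_, ⟨p, rfl⟩, hp⟩ := Metric.exists_edist_lt_of_hausdorffEDist_lt (Set.mem_range_self y) this
    rw [edist_dist, ENNReal.ofReal_lt_ofReal_iff (half_pos hε)] at hp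
    refine ⟨F p, ⟨p, rfl⟩, ?_⟩
    have h1 : dist (G (φ n) y) (F p) = dist (g (φ n) y) (f (φ n) p) := by
      rw [← hJF (φ n), ← hJG (φ n), (J (φ n)).isometry.dist_eq]
      rfl
    have h2 := dist_triangle_left (γ y) (F p) (G (φ n) y)
    linarith
  choose e he using hmem
  have heF : ∀ y y', dist (e y) (e y') = dist y y' := fun y y' => by
    rw [← F.isometry.dist_eq, he, he, hγ.dist_eq]
  let e' : IsomEmb Y X := ⟨e, Isometry.of_dist_eq heF⟩
  refine ⟨e', ?_⟩
  have hFe : F.comp e' = ⟨γ, hγ⟩ := IsomEmb.ext he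
  apply (σ.map_isometry F).injective
  rw [← σ.map_comp, hFe]
  -- The images of `b` under `G (φ n)` tend to that under `γ` by continuity, and to that of `a`
  -- under `F` by `hclose`.
  refine tendsto_nhds_unique (hcont Y E (fun n => G (φ n)) ⟨γ, hγ⟩ hlimg b) ?_
  refine tendsto_iff_edist_tendsto_0.2 (tendsto_of_tendsto_of_tendsto_of_le_of_le
    tendsto_const_nhds (hlim.comp hφ.tendsto_atTop) (fun _ => bot_le) fun n => ?_)
  rw [edist_comm]
  exact (hclose (φ n)).le

end MetFunctor

/-! ### The distance of compact tuples -/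

namespace MetFunctor

lemma PointwiseContinuous.pointed {σ : MetFunctor.{u, v}} (h : σ.PointwiseContinuous) :
    σ.pointed.PointwiseContinuous := fun X Y _ _ _ _ F f hF a =>
  (hF a.1).prodMk_nhds (h X Y F f hF a.2)

section

variable (σ : MetFunctor.{u, v}) {X Y Z W : Type u} [MetricSpace X] [CompactSpace X]
  [MetricSpace Y] [CompactSpace Y] [MetricSpace Z] [CompactSpace Z] [MetricSpace W]
  [CompactSpace W]

/-- The distance of the compact tuples `(X, x₀; a)` and `(Y, y₀; b)`. -/
def pointedDist (x₀ : X) (a : σ.obj X) (y₀ : Y) (b : σ.obj Y) : ℝ≥0∞ :=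
  σ.pointed.ghDist (X := X) (Y := Y) (x₀, a) (y₀, b)

lemma pointedDist_comm (x₀ : X) (a : σ.obj X) (y₀ : Y) (b : σ.obj Y) :
    σ.pointedDist x₀ a y₀ b = σ.pointedDist y₀ b x₀ a :=
  σ.pointed.ghDist_comm _ _

lemma pointedDist_triangle (x₀ : X) (a : σ.obj X) (y₀ : Y) (b : σ.obj Y) (w₀ : W)
    (c : σ.obj W) :
    σ.pointedDist x₀ a w₀ c ≤ σ.pointedDist x₀ a y₀ b + σ.pointedDist y₀ b w₀ c :=
  have : Nonempty Y := ⟨y₀⟩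
  σ.pointed.ghDist_triangle _ _ _

lemma pointedDist_le (x₀ : X) (a : σ.obj X) (y₀ : Y) (b : σ.obj Y) (f : IsomEmb X Z)
    (g : IsomEmb Y Z) :
    σ.pointedDist x₀ a y₀ b ≤ max (Metric.hausdorffEDist (Set.range f) (Set.range g))
      (max (edist (f x₀) (g y₀)) (edist (σ.map f a) (σ.map g b))) :=
  σ.pointed.ghDist_le _ _ f g

lemma exists_of_pointedDist_lt {x₀ : X} {a : σ.obj X} {y₀ : Y} {b : σ.obj Y} {r : ℝ≥0∞}
    (h : σ.pointedDist x₀ a y₀ b < r) :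
    ∃ (Z : Type u) (_ : MetricSpace Z) (_ : CompactSpace Z) (f : IsomEmb X Z) (g : IsomEmb Y Z),
      Metric.hausdorffEDist (Set.range f) (Set.range g) < r ∧ edist (f x₀) (g y₀) < r := by
  obtain ⟨Z, i1, i2, f, g, h1, h2⟩ := σ.pointed.exists_of_ghDist_lt h
  exact ⟨Z, i1, i2, f, g, h1, (le_max_left _ _).trans_lt h2⟩

lemma pointedDist_eq_zero {x₀ : X} {a : σ.obj X} {y₀ : Y} {b : σ.obj Y} (e : IsomEmb X Y)
    (he : Function.Surjective e) (h₀ : e x₀ = y₀) (h : σ.map e a = b) :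
    σ.pointedDist x₀ a y₀ b = 0 :=
  σ.pointed.ghDist_eq_zero_of_surjective e he (Prod.ext h₀ h)

lemma exists_map_eq_of_pointedDist_eq_zero (hcont : σ.PointwiseContinuous) {x₀ : X}
    {a : σ.obj X} {y₀ : Y} {b : σ.obj Y} (h : σ.pointedDist x₀ a y₀ b = 0) :
    ∃ e : IsomEmb X Y, e x₀ = y₀ ∧ σ.map e a = b := by
  rw [pointedDist_comm] at h
  have : Nonempty Y := ⟨y₀⟩
  obtain ⟨e, he⟩ := σ.pointed.exists_map_eq_of_ghDist_eq_zero hcont.pointed h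
  exact ⟨e, congrArg Prod.fst he, congrArg Prod.snd he⟩

end

end MetFunctor

/-! ### Limits of compact tuples below a fixed one -/

namespace PosFunctor

variable {τ : PosFunctor.{u, v}} {P Q : Type u} [MetricSpace P] [CompactSpace P]
  [MetricSpace Q] [CompactSpace Q]

/-- If compact tuples below `(Q, q₀; b)` converge to `(P, p₀; a)`, then `(P, p₀; a)` embeds below
`(Q, q₀; b)`. -/
lemma exists_map_le_of_tendsto_ghDist (hcont : τ.PointwiseContinuous) (hlim : τ.LimitsInImage)
    {p₀ : P} {a : τ.obj P} {q₀ : Q} {b : τ.obj Q} (S : ℕ → Compacts Q) (hS : ∀ n, q₀ ∈ S n)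
    (c : ∀ n, τ.obj (S n)) (hc : ∀ n, τ.map (IsomEmb.subtype (S n)) (c n) ≤ b)
    (h : Tendsto (fun n => τ.pointedDist p₀ a (⟨q₀, hS n⟩ : S n) (c n))
      atTop (𝓝 0)) :
    ∃ f : IsomEmb P Q, f p₀ = q₀ ∧ τ.map f a ≤ b := by
  let N : ℕ → NonemptyCompacts Q := fun n => ⟨S n, ⟨q₀, hS n⟩⟩
  -- The hyperspace of `Q` and the cone below `b` are both compact, so sets and structures converge
  -- together along a subsequence.
  obtain ⟨⟨T, b'⟩, ⟨-, hb'⟩, φ, hφ, hT⟩ :=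
    ((isCompact_univ (X := NonemptyCompacts Q)).prod (τ.isCompact_cone Q b)).tendsto_subseq
      (x := fun n => (N n, τ.map (IsomEmb.subtype (S n)) (c n)))
      fun n => ⟨Set.mem_univ _, hc n⟩
  rw [Prod.tendsto_iff] at hT
  obtain ⟨hT, hcb⟩ := hT
  have hH : Tendsto (fun n => Metric.hausdorffEDist (S (φ n) : Set Q) (T : Set Q)) atTop (𝓝 0) :=
    tendsto_iff_edist_tendsto_0.1 hT
  have hr : ∀ S : Compacts Q, Set.range (IsomEmb.subtype S) = (S : Set Q) :=
    fun S => Subtype.range_coe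
  -- The limit `b'` is so far only an element of `τ(Q)`; this realises it on the limit set `T`.
  obtain ⟨c', hc'⟩ := hlim Q T.toCompacts (fun n => S (φ n)) (IsomEmb.subtype _)
    (fun n => IsomEmb.subtype (S (φ n))) (by simp only [hr]; exact hH) b'
    (fun n => c (φ n)) hcb
  have hq : q₀ ∈ T.toCompacts := by
    have h1 : ∀ n, Metric.infEDist q₀ (T : Set Q) ≤
        Metric.hausdorffEDist (S (φ n) : Set Q) (T : Set Q) := fun n =>
      Metric.infEDist_le_hausdorffEDist_of_mem (hS (φ n))
    have h2 : Metric.infEDist q₀ (T : Set Q) = 0 :=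
      le_antisymm (ge_of_tendsto' hH h1) bot_le
    exact (Metric.mem_iff_infEDist_zero_of_closed T.isCompact.isClosed).2 h2
  have hzero : τ.pointedDist p₀ a (⟨q₀, hq⟩ : T.toCompacts) c' = 0 := by
    refine le_antisymm (ge_of_tendsto' (f := fun n =>
      τ.pointedDist p₀ a (⟨q₀, hS (φ n)⟩ : S (φ n)) (c (φ n)) +
      max (Metric.hausdorffEDist (S (φ n) : Set Q) (T : Set Q))
        (edist (τ.map (IsomEmb.subtype (S (φ n))) (c (φ n))) b')) (x := atTop) ?_ fun n => ?_)
        bot_le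
    · have h1 := (h.comp hφ.tendsto_atTop).add (hH.max (tendsto_iff_edist_tendsto_0.1 hcb))
      simpa using h1
    · refine (τ.pointedDist_triangle _ _ _ _ _ _).trans (add_le_add le_rfl ?_)
      refine (τ.pointedDist_le _ _ _ _ (IsomEmb.subtype (S (φ n)))
        (IsomEmb.subtype T.toCompacts)).trans ?_
      rw [hr, hr, hc']
      exact max_le_max le_rfl (max_le ((edist_self q₀).le.trans bot_le) le_rfl)
  obtain ⟨e, he1, he2⟩ := τ.exists_map_eq_of_pointedDist_eq_zero hcont hzero
  refine ⟨(IsomEmb.subtype T.toCompacts).comp e, congrArg Subtype.val he1, ?_⟩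
  rw [τ.map_comp, he2, hc']
  exact hb'

end PosFunctor

/-! ### Truncation as an adjoint, and the assumptions in terms of embeddings -/

namespace TruncFunctor

variable {τ : PosFunctor.{u, v}} (τt : TruncFunctor τ) {X Y Z : Type u} [MetricSpace X]
  [CompactSpace X] [MetricSpace Y] [CompactSpace Y] [MetricSpace Z] [CompactSpace Z]

/-- The two truncation axioms are the unit and counit of an adjunction; this moves inequalities
between a subspace and the ambient space. -/
lemma gc (f : IsomEmb X Y) : GaloisConnection (τ.map f) (τt.trunc f) := fun a b =>
  ⟨fun h => (τt.trunc_map f a).symm.le.trans (τt.trunc_mono f h),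
    fun h => (τ.map_mono f h).trans (τt.map_trunc_le f b)⟩

lemma trunc_eq_of_comp {g : IsomEmb Y Z} {f : IsomEmb X Y} {h : IsomEmb X Z}
    (hh : ∀ x, g (f x) = h x) (c : τ.obj Z) : τt.trunc f (τt.trunc g c) = τt.trunc h c := by
  rw [← τt.trunc_comp]
  congr 1
  exact IsomEmb.ext hh

end TruncFunctor

/-- The closed ball of a proper metric space as a compact set. -/
def compactBall {X : Type*} [MetricSpace X] [ProperSpace X] (x : X) (r : ℝ) : Compacts X :=
  ⟨Metric.closedBall x r, isCompact_closedBall x r⟩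

namespace IsomEmb

variable {X Y : Type*} [MetricSpace X] [MetricSpace Y]

/-- The image of a compact space under an isometric embedding. -/
def compactRange [CompactSpace X] (f : IsomEmb X Y) : Compacts Y :=
  ⟨Set.range f, isCompact_range f.isometry.continuous⟩

/-- An isometric embedding of a compact space as a map onto its image. -/
def toRange [CompactSpace X] (f : IsomEmb X Y) : IsomEmb X f.compactRange :=
  ⟨fun x => ⟨f x, x, rfl⟩, fun x y => f.isometry x y⟩

lemma toRange_surjective [CompactSpace X] (f : IsomEmb X Y) : Function.Surjective f.toRange := by
  rintro ⟨_, x, rfl⟩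
  exact ⟨x, rfl⟩

end IsomEmb

/-- In a common space, go from `y` to a nearby `x`, then to `x₀`, then to `y₀`: the two jumps cost
`ε` each. -/
lemma MetFunctor.dist_le_of_pointedDist_lt (σ : MetFunctor.{u, v}) {X Y : Type u} [MetricSpace X]
    [CompactSpace X] [MetricSpace Y] [CompactSpace Y] {x₀ : X} {a : σ.obj X} {y₀ : Y}
    {b : σ.obj Y} {ε r : ℝ} (h : σ.pointedDist x₀ a y₀ b < ENNReal.ofReal ε)
    (hr : ∀ x, dist x x₀ ≤ r) (y : Y) : dist y y₀ ≤ r + 2 * ε := by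
  have hε : 0 < ε := ENNReal.ofReal_pos.1 (bot_le.trans_lt h)
  obtain ⟨Z, _, _, f, g, hH, hd⟩ := σ.exists_of_pointedDist_lt h
  rw [Metric.hausdorffEDist_comm] at hH
  obtain ⟨_, ⟨x, rfl⟩, hx⟩ := Metric.exists_edist_lt_of_hausdorffEDist_lt
    (Set.mem_range_self y) hH
  rw [edist_dist, ENNReal.ofReal_lt_ofReal_iff hε] at hx hd
  have h1 := hr x
  have h2 := dist_triangle4 (g y) (f x) (f x₀) (g y₀)
  rw [f.isometry.dist_eq, g.isometry.dist_eq] at h2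
  linarith

lemma MetFunctor.pointedDist_toRange (σ : MetFunctor.{u, v}) {X Y : Type u} [MetricSpace X]
    [CompactSpace X] [MetricSpace Y] (i : IsomEmb X Y) {x₀ : X} {y₀ : Y} (h : i x₀ = y₀)
    (a : σ.obj X) :
    σ.pointedDist x₀ a (⟨y₀, x₀, h⟩ : i.compactRange) (σ.map i.toRange a) = 0 :=
  σ.pointedDist_eq_zero i.toRange i.toRange_surjective (Subtype.ext h) rfl

variable {τ : PosFunctor.{u, v}} {τt : TruncFunctor τ}

section Assumptions

variable {P P' Q : Type u} [MetricSpace P] [CompactSpace P] [MetricSpace P'] [CompactSpace P']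
  [MetricSpace Q] [CompactSpace Q]

lemma SubsetAssumption.exists_le_trunc (h : SubsetAssumption τt) {p₀ : P} {a : τ.obj P}
    (q₀ : Q) (b : τ.obj Q) (S : Compacts P) (hS : p₀ ∈ S) (c : τ.obj S)
    (hc : c ≤ τt.trunc (IsomEmb.subtype S) a) :
    ∃ (T : Compacts Q) (hq : q₀ ∈ T) (d : τ.obj T), d ≤ τt.trunc (IsomEmb.subtype T) b ∧
      τ.pointedDist (⟨p₀, hS⟩ : S) c (⟨q₀, hq⟩ : T) d ≤ τ.pointedDist p₀ a q₀ b := by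
  obtain ⟨B, hle, hdist⟩ := h ⟨P, inferInstance, inferInstance, p₀, a⟩
    ⟨Q, inferInstance, inferInstance, q₀, b⟩ ⟨S, hS, c⟩ hc
  exact ⟨B.set, B.base_mem, B.str, hle, hdist⟩

lemma BallSubsetAssumption.exists_le_trunc (h : BallSubsetAssumption τt) {p₀ : P} {a : τ.obj P}
    (q₀ : Q) (b : τ.obj Q) (S : Compacts P) (hS : p₀ ∈ S) (c : τ.obj S)
    (hc : c ≤ τt.trunc (IsomEmb.subtype S) a) {δ r : ℝ} (hδ : 0 ≤ δ) (hδr : 2 * δ ≤ r)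
    (hdc : τ.pointedDist p₀ a q₀ b = ENNReal.ofReal δ) (hB : compactBall p₀ r ≤ S)
    (hBc : τt.trunc (IsomEmb.subtype _) a ≤ τt.trunc (IsomEmb.incl hB) c) :
    ∃ (T : Compacts Q) (hq : q₀ ∈ T) (d : τ.obj T), d ≤ τt.trunc (IsomEmb.subtype T) b ∧
      τ.pointedDist (⟨p₀, hS⟩ : S) c (⟨q₀, hq⟩ : T) d ≤ τ.pointedDist p₀ a q₀ b ∧
      ∃ hT : compactBall q₀ (r - 2 * δ) ≤ T,
        τt.trunc (IsomEmb.subtype _) b ≤ τt.trunc (IsomEmb.incl hT) d := by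
  obtain ⟨B, ⟨hT, hTd⟩, hle, hdist⟩ := h ⟨P, inferInstance, inferInstance, p₀, a⟩
    ⟨Q, inferInstance, inferInstance, q₀, b⟩ δ r (by linarith) hδr hδ hdc ⟨S, hS, c⟩ ⟨hB, hBc⟩ hc
  exact ⟨B.set, B.base_mem, B.str, hle, hdist, hT, hTd⟩

lemma SubsetAssumption.exists_compacts (h : SubsetAssumption τt) {p₀ : P} {a : τ.obj P}
    (q₀ : Q) (b : τ.obj Q) (i : IsomEmb P' P) {p₀' : P'} (hi : i p₀' = p₀) {a' : τ.obj P'}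
    (ha : τ.map i a' ≤ a) :
    ∃ (T : Compacts Q) (hq : q₀ ∈ T) (d : τ.obj T), τ.map (IsomEmb.subtype T) d ≤ b ∧
      τ.pointedDist p₀' a' (⟨q₀, hq⟩ : T) d ≤ τ.pointedDist p₀ a q₀ b := by
  have hp : p₀ ∈ i.compactRange := ⟨p₀', hi⟩
  obtain ⟨T, hq, d, hle, hdist⟩ := h.exists_le_trunc (a := a) q₀ b i.compactRange hp
    (τ.map i.toRange a')
    ((τt.gc (IsomEmb.subtype i.compactRange) _ _).1 (by rwa [← τ.map_comp]))
  refine ⟨T, hq, d, (τt.gc _ _ _).2 hle, ?_⟩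
  refine (τ.pointedDist_triangle _ _ (⟨p₀, hp⟩ : i.compactRange) (τ.map i.toRange a') _ _).trans ?_
  rw [τ.pointedDist_toRange i hi, zero_add]
  exact hdist

/-- The assumption speaks of subsets of `P`; replacing `P'` by its image costs distance `0`. The map
`k` expresses that the image contains the ball. -/
lemma BallSubsetAssumption.exists_compacts (h : BallSubsetAssumption τt) {p₀ : P} {a : τ.obj P}
    (q₀ : Q) (b : τ.obj Q) (i : IsomEmb P' P) {p₀' : P'} (hi : i p₀' = p₀) {a' : τ.obj P'}
    (ha : τ.map i a' ≤ a) {δ r : ℝ} (hδ : 0 ≤ δ) (hδr : 2 * δ ≤ r)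
    (hdc : τ.pointedDist p₀ a q₀ b = ENNReal.ofReal δ)
    (k : IsomEmb (compactBall p₀ r) P') (hk : ∀ x, i (k x) = x)
    (hka : τt.trunc (IsomEmb.subtype _) a ≤ τt.trunc k a') :
    ∃ (T : Compacts Q) (hq : q₀ ∈ T) (d : τ.obj T), τ.map (IsomEmb.subtype T) d ≤ b ∧
      τ.pointedDist p₀' a' (⟨q₀, hq⟩ : T) d ≤ τ.pointedDist p₀ a q₀ b ∧
      ∃ hT : compactBall q₀ (r - 2 * δ) ≤ T,
        τt.trunc (IsomEmb.subtype _) b ≤ τt.trunc (IsomEmb.incl hT) d := by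
  have hp : p₀ ∈ i.compactRange := ⟨p₀', hi⟩
  have hsub : compactBall p₀ r ≤ i.compactRange := fun x hx => ⟨k ⟨x, hx⟩, hk ⟨x, hx⟩⟩
  have hball : τt.trunc (IsomEmb.subtype _) a ≤
      τt.trunc (IsomEmb.incl hsub) (τ.map i.toRange a') := by
    refine hka.trans (le_of_eq ?_)
    have h1 := τt.trunc_eq_of_comp (g := i.toRange) (f := k) (h := IsomEmb.incl hsub)
      (fun x => Subtype.ext (hk x)) (τ.map i.toRange a')
    rw [← h1, τt.trunc_map]
  obtain ⟨T, hq, d, hle, hdist, hT, hTd⟩ := h.exists_le_trunc q₀ b i.compactRange hp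
    (τ.map i.toRange a')
    ((τt.gc (IsomEmb.subtype i.compactRange) _ _).1 (by rwa [← τ.map_comp])) hδ hδr hdc hsub hball
  refine ⟨T, hq, d, (τt.gc _ _ _).2 hle, ?_, hT, hTd⟩
  refine (τ.pointedDist_triangle _ _ (⟨p₀, hp⟩ : i.compactRange) (τ.map i.toRange a') _ _).trans ?_
  rw [τ.pointedDist_toRange i hi, zero_add]
  exact hdist

end Assumptions

/-! ### Transferring sub-tuples between nearby tuples -/

namespace SubTuple

variable {X Y W : Tuple τt}

lemma dc_triangle (A : SubTuple X) (B : SubTuple Y) (C : SubTuple W) :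
    A.toC.dc C.toC ≤ A.toC.dc B.toC + B.toC.dc C.toC :=
  τ.pointedDist_triangle _ _ _ _ _ _

lemma Preceq.refl (A : SubTuple X) : A.Preceq A := ⟨le_rfl, (τt.trunc_id _ _).symm.le⟩

lemma Preceq.trans {A B C : SubTuple X} (h : A.Preceq B) (h' : B.Preceq C) : A.Preceq C := by
  obtain ⟨h1, h2⟩ := h
  obtain ⟨h3, h4⟩ := h'
  refine ⟨h1.trans h3, (h2.trans (τt.trunc_mono _ h4)).trans (le_of_eq ?_)⟩
  exact τt.trunc_eq_of_comp (fun _ => rfl) _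

lemma Preceq.leWhole {A B : SubTuple X} (h : A.Preceq B) (hB : B.LEWhole) : A.LEWhole := by
  obtain ⟨h1, h2⟩ := h
  exact (h2.trans (τt.trunc_mono _ hB)).trans (X.str.compat _ _ h1).le

lemma LEWhole.preceq_ball {A : SubTuple X} (hA : A.LEWhole) {r : ℝ} (hr : 0 ≤ r)
    (h : A.set ≤ compactBall X.base r) : A.Preceq (X.ball r hr) :=
  ⟨h, hA.trans (X.str.compat _ _ h).symm.le⟩

lemma ball_leWhole (X : Tuple τt) {r : ℝ} (hr : 0 ≤ r) : (X.ball r hr).LEWhole := le_rfl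

lemma ball_preceq_ball (X : Tuple τt) {r s : ℝ} (hr : 0 ≤ r) (hs : 0 ≤ s) (h : r ≤ s) :
    (X.ball r hr).Preceq (X.ball s hs) :=
  (ball_leWhole X hr).preceq_ball hs (Metric.closedBall_subset_closedBall h)

/-- The sub-tuple of `Y` given by a sub-tuple of a sub-tuple of `Y`. -/
def push (B : SubTuple Y) (T : Compacts B.set) (h : ⟨Y.base, B.base_mem⟩ ∈ T) (d : τ.obj T) :
    SubTuple Y where
  set := ((IsomEmb.subtype B.set).comp (IsomEmb.subtype T)).compactRange
  base_mem := ⟨⟨_, h⟩, rfl⟩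
  str := τ.map ((IsomEmb.subtype B.set).comp (IsomEmb.subtype T)).toRange d

lemma push_preceq (B : SubTuple Y) (T : Compacts B.set) (h : ⟨Y.base, B.base_mem⟩ ∈ T)
    (d : τ.obj T) (hd : τ.map (IsomEmb.subtype T) d ≤ B.str) : (B.push T h d).Preceq B := by
  have hle : ((IsomEmb.subtype B.set).comp (IsomEmb.subtype T)).compactRange ≤ B.set := by
    rintro _ ⟨x, rfl⟩
    exact x.1.2
  refine ⟨hle, (τt.gc (IsomEmb.incl hle) _ _).1 (le_trans (le_of_eq ?_) hd)⟩
  exact (τ.map_comp (IsomEmb.incl hle)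
    ((IsomEmb.subtype B.set).comp (IsomEmb.subtype T)).toRange d).symm

lemma dc_push_le (A : SubTuple X) (B : SubTuple Y) (T : Compacts B.set)
    (h : ⟨Y.base, B.base_mem⟩ ∈ T) (d : τ.obj T) : A.toC.dc (B.push T h d).toC ≤
      τ.pointedDist (⟨X.base, A.base_mem⟩ : A.set) A.str (⟨_, h⟩ : T) d := by
  let j := (IsomEmb.subtype B.set).comp (IsomEmb.subtype T)
  have h0 : τ.pointedDist (⟨_, h⟩ : T) d (⟨Y.base, ⟨⟨_, h⟩, rfl⟩⟩ : j.compactRange)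
      (τ.map j.toRange d) = 0 := τ.pointedDist_toRange j rfl d
  have h1 := τ.pointedDist_triangle (⟨X.base, A.base_mem⟩ : A.set) A.str (⟨_, h⟩ : T) d
    (⟨Y.base, ⟨⟨_, h⟩, rfl⟩⟩ : j.compactRange) (τ.map j.toRange d)
  rw [h0, add_zero] at h1
  exact h1

lemma exists_preceq (hsub : SubsetAssumption τt) {A A' : SubTuple X} (hA : A'.Preceq A)
    (B : SubTuple Y) : ∃ B' : SubTuple Y, B'.Preceq B ∧ A'.toC.dc B'.toC ≤ A.toC.dc B.toC := by
  obtain ⟨h1, h2⟩ := hA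
  obtain ⟨T, hq, d, hd, hdist⟩ := hsub.exists_compacts (p₀ := (⟨X.base, A.base_mem⟩ : A.set))
    (a := A.str) (⟨Y.base, B.base_mem⟩ : B.set) B.str (IsomEmb.incl h1)
    (p₀' := ⟨X.base, A'.base_mem⟩) rfl ((τt.gc _ _ _).2 h2)
  exact ⟨B.push T hq d, B.push_preceq T hq d hd, (dc_push_le _ _ _ _ _).trans hdist⟩

lemma exists_preceq_ball (hball : BallSubsetAssumption τt) {A A' : SubTuple X}
    (hA : A'.Preceq A) (hAX : A.LEWhole) (B : SubTuple Y) {ε r s : ℝ} (hε : 2 * ε ≤ r)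
    (hr : 0 ≤ r) (hs : 0 ≤ s) (hrs : s ≤ r - 2 * ε) (hdc : A.toC.dc B.toC < ENNReal.ofReal ε)
    (hA' : (X.ball r hr).Preceq A') (hB : (Y.ball s hs).Preceq B) :
    ∃ B' : SubTuple Y, B'.Preceq B ∧ A'.toC.dc B'.toC ≤ A.toC.dc B.toC ∧
      (Y.ball s hs).Preceq B' := by
  obtain ⟨h1, h2⟩ := hA
  obtain ⟨h3, h4⟩ := hA'
  obtain ⟨h5, h6⟩ := hB
  have hfin : A.toC.dc B.toC ≠ ∞ := hdc.ne_top
  set δ := (A.toC.dc B.toC).toReal with hδdef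
  have hδ : A.toC.dc B.toC = ENNReal.ofReal δ := (ENNReal.ofReal_toReal hfin).symm
  have hδ0 : 0 ≤ δ := ENNReal.toReal_nonneg
  have hδε : δ < ε := by
    rw [hδ] at hdc
    exact (ENNReal.ofReal_lt_ofReal_iff_of_nonneg hδ0).1 hdc
  let p₀ : A.set := ⟨X.base, A.base_mem⟩
  let q₀ : B.set := ⟨Y.base, B.base_mem⟩
  -- The assumption is applied with `A` and `B` as ambient spaces, so its balls are balls of `A` and
  -- `B`; `u` and, below, `w` compare them with those of `X` and `Y`.
  let u : IsomEmb (compactBall p₀ r) (X.ball r hr).set := ⟨fun x => ⟨x.1.1, x.2⟩, fun _ _ => rfl⟩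
  let k : IsomEmb (compactBall p₀ r) A'.set := (IsomEmb.incl h3).comp u
  have hk : τt.trunc (IsomEmb.subtype _) A.str ≤ τt.trunc k A'.str := by
    refine (τt.trunc_mono _ hAX).trans ?_
    have e1 : τt.trunc u (τt.trunc (IsomEmb.incl (h3.trans h1)) (X.str.val A.set)) =
      τt.trunc (IsomEmb.subtype (compactBall p₀ r)) (X.str.val A.set) :=
      τt.trunc_eq_of_comp (fun _ => rfl) _
    rw [← e1, X.str.compat]
    exact (τt.trunc_mono u h4).trans (τt.trunc_comp _ _ _).symm.le
  obtain ⟨T, hq, d, hd, hdist, hT, hTd⟩ := hball.exists_compacts (p₀ := p₀)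
    (a := A.str) q₀ B.str (IsomEmb.incl h1)
    (p₀' := ⟨X.base, A'.base_mem⟩) rfl ((τt.gc _ _ _).2 h2) hδ0 (by linarith) hδ k
    (fun _ => rfl) hk
  refine ⟨B.push T hq d, B.push_preceq T hq d hd, (dc_push_le _ _ _ _ _).trans hdist, ?_⟩
  -- The `s`-ball of `Y` lies in `B` by `h5`, and `s ≤ r - 2ε ≤ r - 2δ`, where `δ` is the exact
  -- distance.
  let w : IsomEmb (Y.ball s hs).set (compactBall q₀ (r - 2 * δ)) :=
    ⟨fun x => ⟨⟨x.1, h5 x.2⟩, le_trans (b := s) x.2 (by linarith)⟩, fun _ _ => rfl⟩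
  let e := ((IsomEmb.subtype B.set).comp (IsomEmb.subtype T)).toRange
  have hle : (Y.ball s hs).set ≤ (B.push T hq d).set := fun x hx =>
    ⟨IsomEmb.incl hT (w ⟨x, hx⟩), rfl⟩
  refine ⟨hle, ?_⟩
  have e1 : τt.trunc ((IsomEmb.incl hT).comp w) (τt.trunc e (τ.map e d)) =
    τt.trunc (IsomEmb.incl hle) (B.push T hq d).str := τt.trunc_eq_of_comp (fun _ => rfl) _
  have e2 : τt.trunc w (τt.trunc (IsomEmb.subtype _) B.str) =
    τt.trunc (IsomEmb.incl h5) B.str := τt.trunc_eq_of_comp (fun _ => rfl) _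
  rw [← e1, τt.trunc_map, τt.trunc_comp]
  exact (h6.trans e2.symm.le).trans (τt.trunc_mono w hTd)

/-- The points of `B` are at most `2ε` farther from the origin than those of `A`. -/
lemma set_le_compactBall {A : SubTuple X} {B : SubTuple Y} {ε r : ℝ}
    (hdc : A.toC.dc B.toC < ENNReal.ofReal ε) (hA : A.set ≤ compactBall X.base r) :
    B.set ≤ compactBall Y.base (r + 2 * ε) :=
  fun y hy =>
  have h : τ.pointedDist (⟨X.base, A.base_mem⟩ : A.set) A.str
    (⟨Y.base, B.base_mem⟩ : B.set) B.str < ENNReal.ofReal ε := hdc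
  τ.dist_le_of_pointedDist_lt h (fun x => hA x.2) ⟨y, hy⟩

end SubTuple

/-! ### The distance of tuples and its triangle inequality -/

section Distance

variable {X Y W : Tuple τt}

lemma exists_of_aDist_lt {ε : ℝ} {hε : ε ∈ Set.Ioc (0 : ℝ) 1} {r : ℝ≥0∞}
    (h : aDist ε hε X Y < r) : ∃ B : SubTuple Y,
      (Y.ball (1 / ε - ε) (inv_sub_self_nonneg hε)).Preceq B ∧ B.LEWhole ∧
        (X.ball (1 / ε) (one_div_pos.2 hε.1).le).toC.dc B.toC < r := by
  simpa only [aDist, iInf_lt_iff, exists_prop] using h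

lemma aDist_le {ε : ℝ} (hε : ε ∈ Set.Ioc (0 : ℝ) 1) {B : SubTuple Y}
    (h : (Y.ball (1 / ε - ε) (inv_sub_self_nonneg hε)).Preceq B) (hB : B.LEWhole) :
    aDist ε hε X Y ≤ (X.ball (1 / ε) (one_div_pos.2 hε.1).le).toC.dc B.toC :=
  iInf_le_of_le B <| iInf_le_of_le h <| iInf_le _ hB

lemma aDist_triangle (hball : BallSubsetAssumption τt) {ε δ : ℝ} (hε : ε ∈ Set.Ioc (0 : ℝ) 1)
    (hδ : δ ∈ Set.Ioc (0 : ℝ) 1) (hεδ : ε + δ ∈ Set.Ioc (0 : ℝ) 1)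
    (h : aDist ε hε X Y < ENNReal.ofReal (ε / 2)) (h' : aDist δ hδ Y W < ENNReal.ofReal (δ / 2)) :
    aDist (ε + δ) hεδ X W < ENNReal.ofReal ((ε + δ) / 2) := by
  obtain ⟨hε0, hε1⟩ := hε
  obtain ⟨hδ0, hδ1⟩ := hδ
  obtain ⟨h0, h1⟩ := hεδ
  obtain ⟨B, hB, hBY, hdB⟩ := exists_of_aDist_lt h
  obtain ⟨C, hC, hCW, hdC⟩ := exists_of_aDist_lt h'
  have hr1 : 1 ≤ 1 / (ε + δ) := one_le_one_div h0 h1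
  have hr0 : 0 ≤ 1 / (ε + δ) := by linarith
  have hrε : 1 / (ε + δ) ≤ 1 / ε := one_div_le_one_div_of_le hε0 (by linarith)
  -- `1/δ - 1/(ε+δ) = ε/(δ(ε+δ))`, and the denominator is at most `1`.
  have hrδ : 1 / (ε + δ) + ε ≤ 1 / δ := by
    rw [← le_sub_iff_add_le', div_sub_div _ _ hδ0.ne' h0.ne', le_div_iff₀ (by positivity)]
    nlinarith [mul_le_one₀ hδ1 h0.le h1]
  have hs0 : 0 ≤ 1 / (ε + δ) - ε := by linarith
  have ht0 : 0 ≤ 1 / (ε + δ) - (ε + δ) := by linarith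
  -- The bound `ε/2` on the distance shifts radii by `2 · ε/2 = ε`, both here and in `hB'1`.
  obtain ⟨B', hB', hdB', hBb⟩ := SubTuple.exists_preceq_ball hball (s := 1 / (ε + δ) - ε)
    (SubTuple.ball_preceq_ball X hr0 (one_div_pos.2 hε0).le hrε) (SubTuple.ball_leWhole X _) B
    (by linarith) hr0 hs0 (by linarith) hdB (SubTuple.Preceq.refl _)
    ((SubTuple.ball_preceq_ball Y _ _ (by linarith)).trans hB)
  have hB'1 := SubTuple.set_le_compactBall (hdB'.trans_lt hdB) (r := 1 / (ε + δ)) le_rfl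
  have hB'2 : B'.Preceq (Y.ball (1 / δ) (one_div_pos.2 hδ0).le) :=
    (hB'.leWhole hBY).preceq_ball _
      (hB'1.trans (Metric.closedBall_subset_closedBall (by linarith)))
  obtain ⟨C', hC', hdC', hCb⟩ := SubTuple.exists_preceq_ball hball (s := 1 / (ε + δ) - (ε + δ))
    hB'2 (SubTuple.ball_leWhole Y _) C
    (by linarith) hs0 ht0 (by linarith) hdC hBb
    ((SubTuple.ball_preceq_ball W _ _ (by linarith)).trans hC)
  refine (aDist_le ⟨h0, h1⟩ hCb (hC'.leWhole hCW)).trans_lt ?_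
  rw [add_div, ENNReal.ofReal_add (by positivity) (by positivity)]
  exact (SubTuple.dc_triangle _ B' _).trans_lt
    (ENNReal.add_lt_add (hdB'.trans_lt hdB) (hdC'.trans_lt hdC))

lemma tupleDist_bddBelow (X Y : Tuple τt) : BddBelow (insert 1 {ε : ℝ |
    ∃ hε : ε ∈ Set.Ioc (0 : ℝ) 1, max (aDist ε hε X Y) (aDist ε hε Y X) <
      ENNReal.ofReal (ε / 2)}) := by
  refine ⟨0, ?_⟩
  rintro _ (rfl | ⟨hε, -⟩)
  · exact zero_le_one
  · exact hε.1.le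

lemma tupleDist_le_one (X Y : Tuple τt) : tupleDist X Y ≤ 1 :=
  csInf_le (tupleDist_bddBelow X Y) (Set.mem_insert _ _)

lemma tupleDist_nonneg (X Y : Tuple τt) : 0 ≤ tupleDist X Y := by
  refine le_csInf (Set.insert_nonempty _ _) ?_
  rintro _ (rfl | ⟨hε, -⟩)
  · exact zero_le_one
  · exact hε.1.le

lemma tupleDist_le {ε : ℝ} (hε : ε ∈ Set.Ioc (0 : ℝ) 1)
    (h : aDist ε hε X Y < ENNReal.ofReal (ε / 2)) (h' : aDist ε hε Y X < ENNReal.ofReal (ε / 2)) :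
    tupleDist X Y ≤ ε :=
  csInf_le (tupleDist_bddBelow X Y) (Or.inr ⟨hε, max_lt h h'⟩)

/-- The condition `r ≤ 1` excludes the added point `1`, the value for the empty set. -/
lemma exists_of_tupleDist_lt {r : ℝ} (h : tupleDist X Y < r) (hr : r ≤ 1) :
    ∃ (ε : ℝ) (hε : ε ∈ Set.Ioc (0 : ℝ) 1), ε < r ∧ aDist ε hε X Y < ENNReal.ofReal (ε / 2) ∧
      aDist ε hε Y X < ENNReal.ofReal (ε / 2) := by
  obtain ⟨ε, rfl | ⟨hε, hlt⟩, hεr⟩ := exists_lt_of_csInf_lt (Set.insert_nonempty _ _) h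
  · exact absurd hr hεr.not_ge
  · exact ⟨ε, hε, hεr, max_lt_iff.1 hlt⟩

lemma tupleDist_comm (X Y : Tuple τt) : tupleDist X Y = tupleDist Y X := by
  unfold tupleDist
  simp only [max_comm]

lemma tupleDist_triangle (hball : BallSubsetAssumption τt) (X Y W : Tuple τt) :
    tupleDist X W ≤ tupleDist X Y + tupleDist Y W := by
  refine le_of_forall_pos_lt_add fun η hη => ?_
  -- Radii can only be composed while `ε + δ ≤ 1`; beyond that, the cap of the distance at `1`
  -- suffices.
  rcases le_or_gt (tupleDist X Y + tupleDist Y W + η) 1 with hlt | hge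
  · have h1 := tupleDist_nonneg X Y
    have h2 := tupleDist_nonneg Y W
    obtain ⟨ε, hε, hεr, ha, hb⟩ := exists_of_tupleDist_lt
      (show tupleDist X Y < tupleDist X Y + η / 2 by linarith) (by linarith)
    obtain ⟨δ, hδ, hδr, ha', hb'⟩ := exists_of_tupleDist_lt
      (show tupleDist Y W < tupleDist Y W + η / 2 by linarith) (by linarith)
    have hεδ : ε + δ ∈ Set.Ioc (0 : ℝ) 1 := ⟨add_pos hε.1 hδ.1, by linarith⟩
    have hδε : δ + ε ∈ Set.Ioc (0 : ℝ) 1 := by rwa [add_comm]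
    have h3 := aDist_triangle hball hδ hε hδε hb' hb
    simp only [add_comm δ ε] at h3
    have := tupleDist_le hεδ (aDist_triangle hball hε hδ hεδ ha ha') h3
    linarith
  · exact (tupleDist_le_one X W).trans_lt hge

lemma aDist_eq_zero_of_iso (h : X.Iso Y) {ε : ℝ} (hε : ε ∈ Set.Ioc (0 : ℝ) 1) :
    aDist ε hε X Y = 0 := by
  obtain ⟨e, he, hmap⟩ := h
  have hr := (one_div_pos.2 hε.1).le
  refine le_antisymm ((aDist_le hε (SubTuple.ball_preceq_ball Y _ hr (by linarith [hε.1]))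
    (SubTuple.ball_leWhole Y hr)).trans (le_of_eq ?_)) bot_le
  have hset : compactBall X.base (1 / ε) = preim e (compactBall Y.base (1 / ε)) := by
    ext x
    change dist x X.base ≤ 1 / ε ↔ dist (e x) Y.base ≤ 1 / ε
    rw [← he, e.dist_eq]
  let i : IsomEmb (compactBall X.base (1 / ε)) (preim e (compactBall Y.base (1 / ε))) :=
    IsomEmb.incl hset.le
  have hx : X.base ∈ compactBall X.base (1 / ε) := Metric.mem_closedBall_self hr
  have hy : Y.base ∈ compactBall Y.base (1 / ε) := Metric.mem_closedBall_self hr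
  have key : τ.pointedDist (⟨X.base, hx⟩ : compactBall X.base (1 / ε)) (X.str.val _)
      (⟨Y.base, hy⟩ : compactBall Y.base (1 / ε)) (Y.str.val _) = 0 := by
    refine τ.pointedDist_eq_zero ((restr e _).comp i) ?_ (Subtype.ext he) ?_
    · rintro ⟨y, hy⟩
      have hy' : e.symm y ∈ compactBall X.base (1 / ε) := by
        rw [hset]
        change e (e.symm y) ∈ compactBall Y.base (1 / ε)
        rwa [e.apply_symm_apply]
      exact ⟨⟨e.symm y, hy'⟩, Subtype.ext (e.apply_symm_apply y)⟩
    · rw [τ.map_comp, X.str.map_val_of_eq hset i fun _ => rfl]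
      exact hmap _
  exact key

lemma tupleDist_eq_zero_of_iso (h : X.Iso Y) : tupleDist X Y = 0 := by
  refine le_antisymm (le_of_forall_pos_lt_add fun η hη => ?_) (tupleDist_nonneg X Y)
  have hε : min (η / 2) 1 ∈ Set.Ioc (0 : ℝ) 1 := ⟨by positivity, min_le_right _ _⟩
  have hpos : (0 : ℝ≥0∞) < ENNReal.ofReal (min (η / 2) 1 / 2) :=
    ENNReal.ofReal_pos.2 (half_pos hε.1)
  refine (tupleDist_le hε ?_ ?_).trans_lt ?_
  · rwa [aDist_eq_zero_of_iso h]
  · rwa [aDist_eq_zero_of_iso ((Tuple.iso_equivalence τt).symm h)]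
  · linarith [min_le_left (η / 2) 1]

end Distance

/-! ### Tuples at distance zero are isomorphic -/

/-- Inequalities on large balls pass to smaller compact sets, by adjunction. -/
lemma Phi.map_val_le_of_le {X Y : Type u} [MetricSpace X] [MetricSpace Y] (a : Phi τt X)
    (b : Phi τt Y) {S S' : Compacts X} {T T' : Compacts Y} (hS : S' ≤ S) (hT : T' ≤ T)
    (f : IsomEmb S T) (f' : IsomEmb S' T') (hf : ∀ x, (f' x : Y) = f (IsomEmb.incl hS x))
    (h : τ.map f (a.val S) ≤ b.val T) : τ.map f' (a.val S') ≤ b.val T' := by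
  rw [← b.compat _ _ hT]
  refine (τt.gc _ _ _).1 ?_
  have hcomp : (IsomEmb.incl hT).comp f' = f.comp (IsomEmb.incl hS) :=
    IsomEmb.ext fun x => Subtype.ext (hf x)
  rw [← τ.map_comp, hcomp, τ.map_comp]
  refine (τ.map_mono f ((τt.gc _ _ _).2 ?_)).trans h
  exact (a.compat _ _ hS).symm.le

/-- The radius `r + 1` does not depend on `η`, so all approximations lie in one compact ball. -/
lemma exists_subTuple_dc_lt (hsub : SubsetAssumption τt) {X Y : Tuple τt}
    (h : tupleDist X Y = 0) {r : ℝ} (hr : 0 ≤ r) {η : ℝ} (hη : 0 < η) :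
    ∃ B : SubTuple Y, B.LEWhole ∧ B.set ≤ compactBall Y.base (r + 1) ∧
      (X.ball r hr).toC.dc B.toC < ENNReal.ofReal η := by
  have hpos : 0 < min (min η 1) (1 / (r + 1)) := by positivity
  obtain ⟨ε, hε, hlt, ha, -⟩ := exists_of_tupleDist_lt (h.trans_lt hpos)
    ((min_le_left _ _).trans (min_le_right _ _))
  have hεη : ε < η := hlt.trans_le ((min_le_left _ _).trans (min_le_left _ _))
  have hεr : r + 1 ≤ 1 / ε := by
    rw [le_one_div (by positivity) hε.1]
    exact (hlt.trans_le (min_le_right _ _)).le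
  obtain ⟨B, -, hBY, hdB⟩ := exists_of_aDist_lt ha
  obtain ⟨B', hB', hdB'⟩ := SubTuple.exists_preceq hsub
    (SubTuple.ball_preceq_ball X hr (one_div_pos.2 hε.1).le (by linarith)) B
  have hlt' := hdB'.trans_lt hdB
  refine ⟨B', hB'.leWhole hBY, ?_, hlt'.trans_le (ENNReal.ofReal_le_ofReal (by linarith [hε.1]))⟩
  exact (SubTuple.set_le_compactBall hlt' (r := r) le_rfl).trans
    (Metric.closedBall_subset_closedBall (by linarith [hε.2]))

/-- If the distance of `X` and `Y` vanishes, every ball of `X` embeds below that of `Y`. -/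
lemma exists_ball_map_le (hsub : SubsetAssumption τt) (hlim : τ.LimitsInImage)
    (hcont : τ.PointwiseContinuous) {X Y : Tuple τt} (h : tupleDist X Y = 0) {r : ℝ}
    (hr : 0 ≤ r) :
    ∃ f : IsomEmb (compactBall X.base r) (compactBall Y.base r),
      (f ⟨X.base, Metric.mem_closedBall_self hr⟩ : Y.carrier) = Y.base ∧
        τ.map f (X.str.val _) ≤ Y.str.val _ := by
  choose B hBY hB hd using fun n : ℕ =>
    exists_subTuple_dc_lt hsub h hr (η := 1 / ((n : ℝ) + 1)) (by positivity)
  have hr1 : 0 ≤ r + 1 := by linarith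
  let q₀ : compactBall Y.base (r + 1) := ⟨Y.base, Metric.mem_closedBall_self hr1⟩
  let i : ∀ n, IsomEmb (B n).set (compactBall Y.base (r + 1)) := fun n => IsomEmb.incl (hB n)
  have hq : ∀ n, q₀ ∈ (i n).compactRange := fun n => ⟨⟨_, (B n).base_mem⟩, rfl⟩
  have hle : ∀ n, τ.map (IsomEmb.subtype (i n).compactRange) (τ.map (i n).toRange (B n).str) ≤
      Y.str.val (compactBall Y.base (r + 1)) := fun n => by
    rw [← τ.map_comp]
    refine (τt.gc (i n) _ _).2 ((hBY n).trans ?_)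
    exact (Y.str.compat _ _ (hB n)).symm.le
  have hto : Tendsto (fun n => τ.pointedDist
      (⟨X.base, Metric.mem_closedBall_self hr⟩ : compactBall X.base r) (X.str.val _)
      (⟨q₀, hq n⟩ : (i n).compactRange) (τ.map (i n).toRange (B n).str)) atTop (𝓝 0) := by
    refine tendsto_of_tendsto_of_tendsto_of_le_of_le tendsto_const_nhds
      (h := fun n : ℕ => ENNReal.ofReal (1 / ((n : ℝ) + 1))) ?_ (fun _ => bot_le) fun n => ?_
    · have := (ENNReal.continuous_ofReal.tendsto 0).comp
        (tendsto_one_div_add_atTop_nhds_zero_nat (𝕜 := ℝ))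
      rwa [ENNReal.ofReal_zero] at this
    · refine (τ.pointedDist_triangle _ _ (⟨Y.base, (B n).base_mem⟩ : (B n).set) (B n).str
        _ _).trans ?_
      have h0 : τ.pointedDist (⟨Y.base, (B n).base_mem⟩ : (B n).set) (B n).str
          (⟨q₀, hq n⟩ : (i n).compactRange) (τ.map (i n).toRange (B n).str) = 0 :=
        τ.pointedDist_toRange (i n) rfl _
      rw [h0, add_zero]
      exact (hd n).le
  obtain ⟨f, hf0, hf⟩ := τ.exists_map_le_of_tendsto_ghDist hcont hlim
    (fun n => (i n).compactRange) hq _ hle hto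
  have hle : compactBall Y.base r ≤ compactBall Y.base (r + 1) :=
    Metric.closedBall_subset_closedBall (by linarith)
  -- An isometry preserving base points keeps the radius, so the extra `1` can be dropped.
  have hmem : ∀ x, (f x : Y.carrier) ∈ compactBall Y.base r := fun x => by
    have h1 : dist (f x) q₀ ≤ r := by
      rw [← hf0, f.isometry.dist_eq]
      exact x.2
    exact h1
  let f' : IsomEmb (compactBall X.base r) (compactBall Y.base r) :=
    ⟨fun x => ⟨f x, hmem x⟩, fun x y => f.isometry x y⟩
  exact ⟨f', congrArg Subtype.val hf0,
    Phi.map_val_le_of_le X.str Y.str le_rfl hle f f' (fun _ => rfl) hf⟩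

/-- If the distance of `X` and `Y` vanishes, `X` embeds below `Y`. -/
lemma exists_isometry_map_le (hsub : SubsetAssumption τt) (hlim : τ.LimitsInImage)
    (hcont : τ.PointwiseContinuous) {X Y : Tuple τt} (h : tupleDist X Y = 0) :
    ∃ G : IsomEmb X.carrier Y.carrier, G X.base = Y.base ∧
      ∀ (m : ℕ) (f : IsomEmb (compactBall X.base m) (compactBall Y.base m)),
        (∀ x, (f x : Y.carrier) = G x) → τ.map f (X.str.val _) ≤ Y.str.val _ := by
  choose f hf0 hf using fun n : ℕ => exists_ball_map_le hsub hlim hcont h (Nat.cast_nonneg n)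
  classical
  -- The embeddings of different balls need not be compatible. Extended by the base point, they are
  -- isometric on each pair of points only eventually, which suffices for a convergent subsequence.
  let g : ℕ → X.carrier → Y.carrier := fun n x =>
    if hx : x ∈ compactBall X.base (n : ℝ) then f n ⟨x, hx⟩ else Y.base
  have hg : ∀ (n : ℕ) x (hx : x ∈ compactBall X.base (n : ℝ)), g n x = f n ⟨x, hx⟩ :=
    fun n x hx => dif_pos hx
  have hball : ∀ x, ∀ᶠ n : ℕ in atTop, x ∈ compactBall X.base (n : ℝ) := fun x =>
    tendsto_natCast_atTop_atTop.eventually (eventually_ge_atTop (dist x X.base))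
  have hdist : ∀ (n : ℕ) x (hx : x ∈ compactBall X.base (n : ℝ)),
      dist (f n ⟨x, hx⟩ : Y.carrier) Y.base = dist x X.base := fun n x hx => by
    refine Eq.trans ?_ ((f n).isometry.dist_eq ⟨x, hx⟩
      ⟨X.base, Metric.mem_closedBall_self (Nat.cast_nonneg n)⟩)
    exact congrArg _ (hf0 n).symm
  obtain ⟨φ, hφ, G, hG, hGlim⟩ := exists_subseq_tendsto_isometry g
    (fun x x' => by
      filter_upwards [hball x, hball x'] with n hx hx'
      rw [hg n x hx, hg n x' hx']
      exact (f n).isometry.dist_eq _ _)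
    (fun x => ⟨_, isCompact_closedBall Y.base (dist x X.base), fun n => by
      by_cases hx : x ∈ compactBall X.base (n : ℝ)
      · rw [hg n x hx]
        exact (hdist n x hx).le
      · simp only [g, dif_neg hx]
        exact Metric.mem_closedBall_self dist_nonneg⟩)
  refine ⟨⟨G, hG⟩, ?_, fun m F hF => ?_⟩
  · refine tendsto_nhds_unique (hGlim X.base) (tendsto_const_nhds.congr fun n => ?_)
    rw [hg _ _ (Metric.mem_closedBall_self (Nat.cast_nonneg _)), hf0]
  -- Restrictions of later embeddings to the `m`-ball converge to `F`. The shift by `m` ensures that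
  -- they are defined on it, and the inequality survives since cones are closed.
  · have hle : ∀ k, m ≤ φ (k + m) := fun k => (Nat.le_add_left m k).trans (hφ.id_le _)
    have hleX : ∀ k, compactBall X.base (m : ℝ) ≤ compactBall X.base (φ (k + m) : ℝ) := fun k =>
      Metric.closedBall_subset_closedBall (Nat.cast_le.2 (hle k))
    have hleY : ∀ k, compactBall Y.base (m : ℝ) ≤ compactBall Y.base (φ (k + m) : ℝ) := fun k =>
      Metric.closedBall_subset_closedBall (Nat.cast_le.2 (hle k))
    let F' : ℕ → IsomEmb (compactBall X.base (m : ℝ)) (compactBall Y.base (m : ℝ)) := fun k =>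
      ⟨fun x => ⟨f (φ (k + m)) (IsomEmb.incl (hleX k) x),
        (hdist _ x (hleX k x.2)).le.trans x.2⟩, fun x y => (f (φ (k + m))).isometry _ _⟩
    have hF' : ∀ k, τ.map (F' k) (X.str.val _) ≤ Y.str.val _ := fun k =>
      Phi.map_val_le_of_le X.str Y.str (hleX k) (hleY k) (f _) (F' k) (fun _ => rfl) (hf _)
    refine (τ.isCompact_cone _ (Y.str.val _)).isClosed.mem_of_tendsto
      (hcont _ _ F' F (fun x => ?_) (X.str.val _)) (Eventually.of_forall hF')
    rw [tendsto_subtype_rng, hF x]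
    refine ((tendsto_add_atTop_iff_nat m).2 (hGlim x)).congr fun k => ?_
    exact hg _ _ (hleX k x.2)

lemma iso_of_tupleDist_eq_zero (hrigid : τ.IsometryRigid) (hsub : SubsetAssumption τt)
    (hlim : τ.LimitsInImage) (hcont : τ.PointwiseContinuous) {X Y : Tuple τt}
    (h : tupleDist X Y = 0) : X.Iso Y := by
  obtain ⟨G, hG0, hG⟩ := exists_isometry_map_le hsub hlim hcont h
  obtain ⟨H, hH0, hH⟩ := exists_isometry_map_le hsub hlim hcont ((tupleDist_comm Y X).trans h)
  have hGd : ∀ x, dist (G x) Y.base = dist x X.base := fun x => by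
    rw [← hG0, G.isometry.dist_eq]
  have hHd : ∀ y, dist (H y) X.base = dist y Y.base := fun y => by
    rw [← hH0, H.isometry.dist_eq]
  let Gm : ∀ m : ℕ, IsomEmb (compactBall X.base (m : ℝ)) (compactBall Y.base (m : ℝ)) := fun m =>
    ⟨fun x => ⟨G x, (hGd x).le.trans x.2⟩, fun x y => G.isometry x y⟩
  let Hm : ∀ m : ℕ, IsomEmb (compactBall Y.base (m : ℝ)) (compactBall X.base (m : ℝ)) := fun m =>
    ⟨fun x => ⟨H x, (hHd x).le.trans x.2⟩, fun x y => H.isometry x y⟩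
  have hGm : ∀ m, τ.map (Gm m) (X.str.val _) = Y.str.val _ := fun m => by
    have h1 := hG m (Gm m) fun _ => rfl
    have h2 := hH m (Hm m) fun _ => rfl
    have h3 := τ.map_mono (Hm m) h1
    have h4 : τ.map (Hm m) (τ.map (Gm m) (X.str.val _)) = X.str.val _ := by
      rw [← τ.map_comp] at h3 ⊢
      exact hrigid _ _ (surjective_of_isometry ((Hm m).comp (Gm m)).isometry) _ (h3.trans h2)
    apply (τ.map_isometry (Hm m)).injective
    -- The image of `Y`'s structure under `Hm m` lies between that of `X` and its image under the
    -- composite, which rigidity made equal.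
    exact le_antisymm h3 (h2.trans h4.symm.le)
  have hsurj : Function.Surjective G := fun y => by
    obtain ⟨m, hm⟩ := exists_nat_ge (dist y Y.base)
    obtain ⟨x, hx⟩ := surjective_of_isometry ((Gm m).comp (Hm m)).isometry ⟨y, hm⟩
    exact ⟨Hm m x, congrArg Subtype.val hx⟩
  let e : X.carrier ≃ᵢ Y.carrier :=
    ⟨Equiv.ofBijective G ⟨G.isometry.injective, hsurj⟩, G.isometry⟩
  refine ⟨e, hG0, fun T => ?_⟩
  obtain ⟨m, hm⟩ : ∃ m : ℕ, T ≤ compactBall Y.base (m : ℝ) := by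
    obtain ⟨r, hr⟩ := T.isCompact.isBounded.subset_closedBall Y.base
    obtain ⟨m, hm⟩ := exists_nat_ge r
    exact ⟨m, hr.trans (Metric.closedBall_subset_closedBall hm)⟩
  have hmX : preim e T ≤ compactBall X.base (m : ℝ) := fun x hx =>
    (hGd x).symm.le.trans (hm hx)
  have hes : ∀ y, dist (e.symm y) X.base = dist y Y.base := fun y => by
    rw [← hGd]
    exact congrArg (dist · Y.base) (e.apply_symm_apply y)
  let Em : IsomEmb (compactBall Y.base (m : ℝ)) (compactBall X.base (m : ℝ)) :=
    ⟨fun y => ⟨e.symm y, (hes y).le.trans y.2⟩, fun x y => e.symm.isometry x y⟩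
  let E : IsomEmb T (preim e T) :=
    ⟨fun y => ⟨e.symm y, by
      change e (e.symm y) ∈ T
      rw [e.apply_symm_apply]
      exact y.2⟩, fun x y => e.symm.isometry x y⟩
  have hEm : τ.map Em (Y.str.val _) ≤ X.str.val _ := by
    have : Em.comp (Gm m) = IsomEmb.id _ :=
      IsomEmb.ext fun x => Subtype.ext (e.symm_apply_apply x)
    rw [← hGm m, ← τ.map_comp, this, τ.map_id]
  have hE : (restr e T).comp E = IsomEmb.id _ :=
    IsomEmb.ext fun y => Subtype.ext (e.apply_symm_apply y)
  -- Restriction to `T` preserves only inequalities, so the equality on the ball is used for `e` and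
  -- for its inverse.
  refine le_antisymm ?_ ?_
  · exact Phi.map_val_le_of_le X.str Y.str hmX hm (Gm m) (restr e T) (fun _ => rfl) (hGm m).le
  · have h1 := τ.map_mono (restr e T)
      (Phi.map_val_le_of_le Y.str X.str hm hmX Em E (fun _ => rfl) hEm)
    rwa [← τ.map_comp, hE, τ.map_id] at h1

end GHFunctor

end

theorem theorem4p5 (τ : GHFunctor.PosFunctor.{u, v}) (τt : GHFunctor.TruncFunctor τ)
    (hrigid : τ.IsometryRigid)
    (hsub : GHFunctor.SubsetAssumption τt)
    (hball : GHFunctor.BallSubsetAssumption τt)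
    (hlim : τ.LimitsInImage)
    (hcont : τ.PointwiseContinuous) :
    ∃ m : MetricSpace (GHFunctor.CPrime τt), ∀ X Y : GHFunctor.Tuple τt,
      m.dist (GHFunctor.CPrime.mk X) (GHFunctor.CPrime.mk Y) = GHFunctor.tupleDist X Y := by
  have hwd : ∀ X Y X' Y' : GHFunctor.Tuple τt, X.Iso X' → Y.Iso Y' →
      GHFunctor.tupleDist X Y = GHFunctor.tupleDist X' Y' := by
    have key : ∀ X Y X' Y' : GHFunctor.Tuple τt, X.Iso X' → Y.Iso Y' →
        GHFunctor.tupleDist X Y ≤ GHFunctor.tupleDist X' Y' := fun X Y X' Y' hX hY => by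
      have h1 := GHFunctor.tupleDist_triangle hball X X' Y
      have h2 := GHFunctor.tupleDist_triangle hball X' Y' Y
      rw [GHFunctor.tupleDist_eq_zero_of_iso hX] at h1
      rw [GHFunctor.tupleDist_comm Y' Y, GHFunctor.tupleDist_eq_zero_of_iso hY] at h2
      linarith
    have hsymm := fun {X Y} => (GHFunctor.Tuple.iso_equivalence τt).symm (x := X) (y := Y)
    exact fun X Y X' Y' hX hY => le_antisymm (key _ _ _ _ hX hY)
      (key _ _ _ _ (hsymm hX) (hsymm hY))
  refine ⟨{
    dist := Quotient.lift₂ (s₁ := GHFunctor.Tuple.setoid τt) (s₂ := GHFunctor.Tuple.setoid τt)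
      GHFunctor.tupleDist hwd
    dist_self := ?_
    dist_comm := ?_
    dist_triangle := ?_
    eq_of_dist_eq_zero := ?_ }, fun X Y => rfl⟩
  · rintro ⟨X⟩
    exact GHFunctor.tupleDist_eq_zero_of_iso ((GHFunctor.Tuple.iso_equivalence τt).refl X)
  · rintro ⟨X⟩ ⟨Y⟩
    exact GHFunctor.tupleDist_comm X Y
  · rintro ⟨X⟩ ⟨Y⟩ ⟨W⟩
    exact GHFunctor.tupleDist_triangle hball X Y W
  · rintro ⟨X⟩ ⟨Y⟩ h
    exact Quotient.sound (GHFunctor.iso_of_tupleDist_eq_zero hrigid hsub hlim hcont h)
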